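/- **Setting.** Let $\mathfrak C$ be an algebraically closed valued field of residue characteristic $0$ (hence of characteristic $0$), regarded as a structure with the field sort $\mathrm{VF}$, the sort $\mathrm{RV}=\mathrm{VF}^\times/(1+\mathfrak m)\cup\{\infty\}$ with $\mathrm{rv}:\mathrm{VF}\to\mathrm{RV}$, $\mathrm{rv}(0)=\infty$ (in the language $\mathcal L_{\mathrm{RV}}$: ring operations on $\mathrm{VF}$; multiplication, $1$, $\infty$, the preorder $\le$ induced by the valuation, and the residue field operations on $\mathrm{RV}$; the map $\mathrm{rv}$), and the imaginary sort $\Gamma\cup\{\infty\}$. Let $S$ be a set of elements of the three sorts and assume that $\mathfrak C$ is $\kappa$-saturated for some infinite cardinal $\kappa>|S|$. "Definable" means $S$-definable, and $\operatorname{acl}(A)$ means model-theoretic algebraic closure of $S\cup A$. **Categories.** An object of $\mathrm{RV}[k,\cdot]$ is a definable pair $(U,f)$ with $U\subseteq\mathrm{RV}^m$ for some $m$ and $f=(f_1,\dots,f_k):U\to\mathrm{RV}^k$ ($\mathrm{RV}^0$ is a singleton). The weight $\operatorname{wgt}\bar t$ of a tuple is the number of its coordinates different from $\infty$. A morphism $F:(U,f)\to(U',f')$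 is a definable function $F:U\to U'$ such that $\operatorname{wgt} f(u)\le\operatorname{wgt} f'(F(u))$ for all $u\in U$, and $(f'\circ F)(f^{-1}(\bar t))$ is finite for all $\bar t\in f(U)$. A subobject of $(U,f)$ is the restriction of $f$ to a definable subset of $U$. The Grothendieck semigroup $\mathbf K_+\mathrm{RV}[k,\cdot]$ is the commutative monoid of isomorphism classes with addition induced by disjoint union. $\mathrm{RV}[*,\cdot]$ is the direct sum of the categories $\mathrm{RV}[k,\cdot]$, $k\ge0$, and $\mathbf K_+\mathrm{RV}[*,\cdot]=\bigoplus_{k\ge 0}\mathbf K_+\mathrm{RV}[k,\cdot]$ is a commutative graded semiring with $[(U,f)][(U',f')]=[(U\times U',f\times f')]$. **Blowups.** Let $(Y,f)\in\mathrm{RV}[k,\cdot]$ and $1\le j\le k$ be such that, for every $t\in Y$, $f_j(t)\ne\infty$ and $f_j(t)\in\operatorname{acl}(f_i(t):i\ne j)$. The elementary blowup of $(Y,f)$ (in the $j$-th coordinate) is $(Y,f)^\sharp=(Y\times\mathrm{RV}^{>1},f^\sharp)$, where $\mathrm{RV}^{>1}=\{s\in\mathrm{RV}:1<s\}$ (containing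 $\infty$) and $f^\sharp(t,s)$ is $f(t)$ with the $j$-th coordinate replaced by $s\,f_j(t)$. If $C\subseteq X$ is definable and $(Y,f)$ is isomorphic to $(C,g{\restriction}C)$, then $(Y,f)^\sharp\uplus(X\smallsetminus C,g{\restriction}(X\smallsetminus C))$ is a blowup of $(X,g)$. An iterated blowup is a composition of finitely many (possibly zero) blowups. Let $\mathrm I_{\mathrm{sp}}[k,\cdot]$ be the relation on objects of $\mathrm{RV}[k,\cdot]$ that holds for two objects if and only if they have isomorphic iterated blowups, and let $\mathrm I_{\mathrm{sp}}[*,\cdot]$ be the direct sum of the relations $\mathrm I_{\mathrm{sp}}[k,\cdot]$, $k\ge0$. **Lemma.** For every $k\ge 0$, $\mathrm I_{\mathrm{sp}}[k,\cdot]$ depends only on isomorphism classes and is a semigroup congruence relation on $\mathbf K_+\mathrm{RV}[k,\cdot]$, that is, an equivalence relation compatible with addition. Moreover, $\mathrm I_{\mathrm{sp}}[*,\cdot]$ is a semiring congruence relation on $\mathbf K_+\mathrm{RV}[*,\cdot]$, that is, an equivalence relation compatible with addition and multiplication. -/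

import Mathlib

open scoped Cardinal FirstOrder DirectSum

namespace ACVF

universe u w

noncomputable section

/-! ### The sorts `VF`, `RV`, `Γ ∪ {∞}` of a valued field -/

section Sorts

variable {K : Type u} [Field K] {Γ₀ : Type w} [LinearOrderedCommGroupWithZero Γ₀]

/-- The subgroup `1 + 𝔪` of `Kˣ`. Valuations are written multiplicatively, as in Mathlib: the
maximal ideal is `{a | v a < 1}`. -/
def oneUnits (v : Valuation K Γ₀) : Subgroup Kˣ where
  carrier := {a | v ((a : K) - 1) < 1}
  one_mem' := by simp
  mul_mem' := by
    intro a b ha hb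
    simp only [Set.mem_ofPred_eq] at *
    have h : ((a * b : Kˣ) : K) - 1 = ((a : K) - 1) * ((b : K) - 1) + (((a : K) - 1) + ((b : K) - 1)) := by
      push_cast; ring
    rw [h]
    refine v.map_add_lt ?_ (v.map_add_lt ha hb)
    rw [map_mul]
    exact mul_lt_one' ha hb
  inv_mem' := by
    intro a ha
    simp only [Set.mem_ofPred_eq] at *
    have h1 : v (a : K) = 1 := by
      have := Valuation.map_one_add_of_lt (v := v) (x := (a : K) - 1) ha
      simpa using this
    have h : ((a⁻¹ : Kˣ) : K) - 1 = -((a : K)⁻¹ * ((a : K) - 1)) := by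
      have := a.ne_zero
      push_cast; field_simp; ring
    rw [h, Valuation.map_neg, map_mul, map_inv₀, h1]
    simpa using ha

lemma oneUnits_val {v : Valuation K Γ₀} {a : Kˣ} (ha : a ∈ oneUnits v) : v (a : K) = 1 := by
  have := Valuation.map_one_add_of_lt (v := v) (x := (a : K) - 1) ha
  simpa using this

/-- The sort `RV = RV^× ∪ {∞}` with `RV^× = Kˣ / (1 + 𝔪)`. The extra element `∞` is the zero of
`WithZero`; it satisfies `t * ∞ = ∞`. -/
def RV (v : Valuation K Γ₀) : Type u := WithZero (Kˣ ⧸ oneUnits v)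

instance instRV (v : Valuation K Γ₀) : CommGroupWithZero (RV v) :=
  inferInstanceAs (CommGroupWithZero (WithZero (Kˣ ⧸ oneUnits v)))

/-- The element `∞ = rv 0` of `RV`. -/
abbrev rvInf (v : Valuation K Γ₀) : RV v := 0

/-- The quotient map `Kˣ → RV^×`, with values in `RV`. -/
def rvUnit (v : Valuation K Γ₀) (a : Kˣ) : RV v :=
  WithZero.coe (QuotientGroup.mk a : Kˣ ⧸ oneUnits v)

open Classical in
/-- The map `rv : VF → RV`. -/
def rv (v : Valuation K Γ₀) (a : K) : RV v :=
  if h : a = 0 then rvInf v else rvUnit v (Units.mk0 a h)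

/-- The map `RV → Γ ∪ {∞}`, so that `vrv (rv a) = v a`. In Mathlib's multiplicative convention the
value group carries the reverse of the additive order and `∞` becomes the least element `0`. -/
def vrv (v : Valuation K Γ₀) : RV v →*₀ Γ₀ :=
  WithZero.lift' (QuotientGroup.lift (oneUnits v)
    (v.toMonoidWithZeroHom.toMonoidHom.comp (Units.coeHom K))
    (fun a ha => by simpa [MonoidHom.mem_ker] using oneUnits_val ha))

lemma vrv_rv (v : Valuation K Γ₀) (a : K) : vrv v (rv v a) = v a := by
  by_cases h : a = 0
  · simp [rv, h]
  · rw [rv, dif_neg h]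
    rfl

/-- The underlying set of the structure: the disjoint union of the sorts `VF = K`, `RV` and the
imaginary sort `Γ ∪ {∞} = Γ₀`. -/
inductive Elem (v : Valuation K Γ₀) : Type (max u w)
  | vf (a : K) : Elem v
  | rv (t : RV v) : Elem v
  | gam (γ : Γ₀) : Elem v

end Sorts

/-! ### The language and the structure -/

/-- The symbols of the language `L_RV` (together with the imaginary sort `Γ ∪ {∞}`), coded as a
one-sorted relational language: there is a predicate for each sort, and each function symbol is
replaced by its graph. -/
inductive LRel : ℕ → Type
  | isVF : LRel 1
  | isRV : LRel 1
  | isGam : LRel 1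
  | vfZero : LRel 1
  | vfOne : LRel 1
  | vfAdd : LRel 3
  | vfNeg : LRel 2
  | vfMul : LRel 3
  | rvOne : LRel 1
  | rvInf : LRel 1
  | rvMul : LRel 3
  | resUnit : LRel 1
  | resAdd : LRel 3
  | resNeg : LRel 2
  | rvLe : LRel 2
  | rvMap : LRel 2
  | vrvMap : LRel 2
  | gamMul : LRel 3
  | gamLe : LRel 2

/-- The language `L_RV`, coded as a one-sorted relational language. -/
def LRV : FirstOrder.Language.{0, 0} := ⟨fun _ => Empty, LRel⟩

section Structure

variable {K : Type u} [Field K] {Γ₀ : Type w} [LinearOrderedCommGroupWithZero Γ₀]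

/-- The interpretation of the symbols. The order on `RV` is the one with top element `∞`:
`s ≤ t` iff `vrv t ≤ vrv s` in multiplicative notation. The set of `t` with `vrv t = 1` is the
multiplicative group of the residue field `𝕂`; `resAdd s t r` is the relation `s + t = r` between
nonzero elements of `𝕂`, and `resNeg s t` is `t = -s`, that is, `s + t = 0` (the element `0` of
`𝕂` is not put into the sort). -/
def relInterp (v : Valuation K Γ₀) : {n : ℕ} → LRel n → (Fin n → Elem v) → Prop
  | _, .isVF, x => ∃ a, x 0 = .vf a
  | _, .isRV, x => ∃ t, x 0 = .rv t
  | _, .isGam, x => ∃ γ, x 0 = .gam γ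
  | _, .vfZero, x => x 0 = .vf 0
  | _, .vfOne, x => x 0 = .vf 1
  | _, .vfAdd, x => ∃ a b, x 0 = .vf a ∧ x 1 = .vf b ∧ x 2 = .vf (a + b)
  | _, .vfNeg, x => ∃ a, x 0 = .vf a ∧ x 1 = .vf (-a)
  | _, .vfMul, x => ∃ a b, x 0 = .vf a ∧ x 1 = .vf b ∧ x 2 = .vf (a * b)
  | _, .rvOne, x => x 0 = .rv 1
  | _, .rvInf, x => x 0 = .rv (rvInf v)
  | _, .rvMul, x => ∃ s t, x 0 = .rv s ∧ x 1 = .rv t ∧ x 2 = .rv (s * t)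
  | _, .resUnit, x => ∃ t, vrv v t = 1 ∧ x 0 = .rv t
  | _, .resAdd, x => ∃ a b : K, v a = 1 ∧ v b = 1 ∧ v (a + b) = 1 ∧
      x 0 = .rv (rv v a) ∧ x 1 = .rv (rv v b) ∧ x 2 = .rv (rv v (a + b))
  | _, .resNeg, x => ∃ a : K, v a = 1 ∧ x 0 = .rv (rv v a) ∧ x 1 = .rv (rv v (-a))
  | _, .rvLe, x => ∃ s t, vrv v t ≤ vrv v s ∧ x 0 = .rv s ∧ x 1 = .rv t
  | _, .rvMap, x => ∃ a, x 0 = .vf a ∧ x 1 = .rv (rv v a)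
  | _, .vrvMap, x => ∃ t, x 0 = .rv t ∧ x 1 = .gam (vrv v t)
  | _, .gamMul, x => ∃ γ δ, x 0 = .gam γ ∧ x 1 = .gam δ ∧ x 2 = .gam (γ * δ)
  | _, .gamLe, x => ∃ γ δ, δ ≤ γ ∧ x 0 = .gam γ ∧ x 1 = .gam δ

instance instStructure (v : Valuation K Γ₀) : LRV.Structure (Elem v) where
  funMap := fun f _ => Empty.elim f
  RelMap := fun r x => relInterp v r x

end Structure

/-- `κ`-saturation of a first-order structure: every finitely satisfiable set of formulas in
finitely many variables over fewer than `κ` parameters is satisfiable. -/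
def IsSaturated (L : FirstOrder.Language.{0, 0}) (M : Type u) [L.Structure M] (κ : Cardinal.{u}) : Prop :=
  ∀ A : Set M, #A < κ → ∀ (n : ℕ) (p : Set (L[[A]].Formula (Fin n))),
    (∀ q : Finset (L[[A]].Formula (Fin n)), (q : Set (L[[A]].Formula (Fin n))) ⊆ p →
      ∃ x : Fin n → M, ∀ φ ∈ q, φ.Realize x) →
    ∃ x : Fin n → M, ∀ φ ∈ p, φ.Realize x

/-! ### Definable subsets of powers of `RV` -/

section Definable

variable {K : Type u} [Field K] {Γ₀ : Type w} [LinearOrderedCommGroupWithZero Γ₀]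
  {v : Valuation K Γ₀} {S : Set (Elem v)} {α β : Type}

/-- `D` is an `S`-definable subset of `RV^α`: it is the set of points of `RV^α` in a subset that is
defined by a formula with parameters from `S`. -/
def RVDef (S : Set (Elem v)) (D : Set (α → RV v)) : Prop :=
  ∃ E : Set (α → Elem v), S.Definable LRV E ∧ D = {t | (fun i => Elem.rv (t i)) ∈ E}

/-- `b ∈ acl(S, A)`: some finite set definable over `S ∪ A` contains `b`. -/
def InAcl (S : Set (Elem v)) (A : Set (RV v)) (b : RV v) : Prop :=
  ∃ D : Set (Elem v), (S ∪ Elem.rv '' A).Definable₁ LRV D ∧ D.Finite ∧ Elem.rv b ∈ D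

lemma RVDef.inter {D E : Set (α → RV v)} (hD : RVDef S D) (hE : RVDef S E) : RVDef S (D ∩ E) := by
  obtain ⟨D', h1, rfl⟩ := hD
  obtain ⟨E', h2, rfl⟩ := hE
  exact ⟨_, h1.inter h2, rfl⟩

lemma RVDef.union {D E : Set (α → RV v)} (hD : RVDef S D) (hE : RVDef S E) : RVDef S (D ∪ E) := by
  obtain ⟨D', h1, rfl⟩ := hD
  obtain ⟨E', h2, rfl⟩ := hE
  exact ⟨_, h1.union h2, rfl⟩

lemma RVDef.compl {D : Set (α → RV v)} (hD : RVDef S D) : RVDef S Dᶜ := by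
  obtain ⟨D', h1, rfl⟩ := hD
  exact ⟨_, h1.compl, rfl⟩

lemma RVDef.empty : RVDef S (∅ : Set (α → RV v)) := ⟨∅, Set.definable_empty, rfl⟩

lemma RVDef.univ : RVDef S (Set.univ : Set (α → RV v)) := ⟨Set.univ, Set.definable_univ, rfl⟩

lemma RVDef.iInter {ι : Type} [Finite ι] {D : ι → Set (α → RV v)} (h : ∀ i, RVDef S (D i)) :
    RVDef S (⋂ i, D i) := by
  choose E hE hD using h
  refine ⟨_, Set.definable_iInter_of_finite hE, ?_⟩
  ext t
  simp [hD]

lemma RVDef.preimage {D : Set (α → RV v)} (hD : RVDef S D) (f : α → β) :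
    RVDef S {t : β → RV v | t ∘ f ∈ D} := by
  obtain ⟨D', h1, rfl⟩ := hD
  exact ⟨_, h1.preimage_comp f, rfl⟩

lemma definable_rel {n : ℕ} (r : LRel n) (c : Fin n → α) :
    S.Definable LRV {x : α → Elem v | relInterp v r (x ∘ c)} := by
  refine ⟨FirstOrder.Language.Relations.formula (L := LRV[[S]]) (Sum.inl r)
    (fun i => FirstOrder.Language.Term.var (c i)), ?_⟩
  ext x
  simp only [Set.mem_ofPred_eq]
  rfl

lemma RVDef.rel {n : ℕ} (r : LRel n) (c : Fin n → α) :
    RVDef S {t : α → RV v | relInterp v r (fun i => Elem.rv (t (c i)))} :=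
  ⟨_, definable_rel r c, rfl⟩

lemma RVDef.eq_one (a : α) : RVDef S {t : α → RV v | t a = 1} := by
  convert RVDef.rel (v := v) (S := S) LRel.rvOne (fun _ => a) using 2
  ext t; simp [relInterp]

lemma RVDef.eq_inf (a : α) : RVDef S {t : α → RV v | t a = 0} := by
  convert RVDef.rel (v := v) (S := S) LRel.rvInf (fun _ => a) using 2
  ext t; simp [relInterp]

lemma RVDef.eq_mul (a b c : α) : RVDef S {t : α → RV v | t c = t a * t b} := by
  convert RVDef.rel (v := v) (S := S) LRel.rvMul ![a, b, c] using 2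
  ext t; simp [relInterp]

lemma RVDef.eq_coord (a b : α) : RVDef S {t : α → RV v | t a = t b} := by
  refine ⟨{x | x a = x b}, ⟨(FirstOrder.Language.Term.var a).equal (FirstOrder.Language.Term.var b), ?_⟩, ?_⟩
  · ext x; simp
  · ext t; simp

lemma RVDef.exists [Finite β] {D : Set (α ⊕ β → RV v)} (hD : RVDef S D) :
    RVDef S {t : α → RV v | ∃ s : β → RV v, Sum.elim t s ∈ D} := by
  obtain ⟨D', h1, rfl⟩ := hD
  have h2 : S.Definable LRV {x : α ⊕ β → Elem v | ∀ b, ∃ t, x (Sum.inr b) = .rv t} := by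
    have := Set.definable_iInter_of_finite (fun b : β => definable_rel (S := S) (v := v)
      LRel.isRV (fun _ => (Sum.inr b : α ⊕ β)))
    convert this using 1
    ext x; simp [relInterp]
  refine ⟨_, (h1.inter h2).exists_of_finite, ?_⟩
  have key : ∀ (t : α → RV v) (s : β → RV v),
      (fun i => Elem.rv (Sum.elim t s i)) =
        Sum.elim (fun i => Elem.rv (t i)) (fun i => Elem.rv (v := v) (s i)) := by
    intro t s; funext i; cases i <;> rfl
  ext t
  simp only [Set.mem_ofPred_eq, key, Set.mem_inter_iff, Sum.elim_inr]
  constructor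
  · rintro ⟨s, hs⟩
    exact ⟨_, hs, fun b => ⟨s b, rfl⟩⟩
  · rintro ⟨x, hx, hb⟩
    choose s hs using hb
    obtain rfl : x = fun b => Elem.rv (s b) := funext hs
    exact ⟨s, hx⟩

lemma RVDef.gt_one (a : α) : RVDef S {t : α → RV v | vrv v (t a) < 1} := by
  have h : RVDef S ({t : α ⊕ Fin 1 → RV v | vrv v (t (Sum.inl a)) < vrv v (t (Sum.inr 0))}) := by
    convert (RVDef.rel (v := v) (S := S) LRel.rvLe
      ![Sum.inl a, (Sum.inr 0 : α ⊕ Fin 1)]).compl using 1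
    ext t; simp [relInterp]
  convert (h.inter (RVDef.eq_one (Sum.inr 0))).exists using 1
  ext t
  simp only [Set.mem_ofPred_eq, Set.mem_inter_iff, Sum.elim_inl, Sum.elim_inr]
  constructor
  · intro h
    exact ⟨fun _ => 1, by simpa using h, rfl⟩
  · rintro ⟨s, hs, h1⟩
    simpa [h1] using hs

end Definable

/-! ### Parametrised definable sets -/

section Families

variable {K : Type u} [Field K] {Γ₀ : Type w} [LinearOrderedCommGroupWithZero Γ₀]
  {v : Valuation K Γ₀} {S : Set (Elem v)} {α β γ : Type} {T T' : Type*}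

/-- The image of the family `h` is definable. -/
def DefFam (S : Set (Elem v)) (h : T → α → RV v) : Prop := RVDef S (Set.range h)

/-- A definable function `RV^α → RV`. -/
def DefTerm (S : Set (Elem v)) (g : (α → RV v) → RV v) : Prop :=
  ∀ {β : Type} (e : α → β) (c : β), RVDef S {z : β → RV v | z c = g (z ∘ e)}

/-- A definable function `RV^α → RV^β`, given by its coordinates. -/
def DefTuple (S : Set (Elem v)) (g : (α → RV v) → β → RV v) : Prop :=
  ∀ b, DefTerm S (fun t => g t b)

lemma DefTerm.proj (a : α) : DefTerm S (fun t : α → RV v => t a) :=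
  fun e c => RVDef.eq_coord c (e a)

lemma DefTerm.one : DefTerm S (fun _ : α → RV v => 1) := fun _ c => RVDef.eq_one c

lemma DefTerm.inf : DefTerm S (fun _ : α → RV v => 0) := fun _ c => RVDef.eq_inf c

lemma DefTerm.mul (a b : α) : DefTerm S (fun t : α → RV v => t a * t b) :=
  fun e c => RVDef.eq_mul (e a) (e b) c

lemma DefTuple.sum {g : (α → RV v) → β → RV v} {g' : (α → RV v) → γ → RV v}
    (h : DefTuple S g) (h' : DefTuple S g') : DefTuple S (fun t => Sum.elim (g t) (g' t)) := by
  rintro (b | b)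
  · exact h b
  · exact h' b

lemma DefTuple.append {m n : ℕ} {g : (α → RV v) → Fin m → RV v} {g' : (α → RV v) → Fin n → RV v}
    (h : DefTuple S g) (h' : DefTuple S g') : DefTuple S (fun t => Fin.append (g t) (g' t)) := by
  intro b
  refine Fin.addCases (fun i => ?_) (fun i => ?_) b
  · simpa using h i
  · simpa using h' i

lemma DefTuple.one : DefTuple S (fun (_ : α → RV v) (_ : β) => 1) := fun _ => DefTerm.one

lemma DefTuple.inf : DefTuple S (fun (_ : α → RV v) (_ : β) => 0) := fun _ => DefTerm.inf

lemma DefTuple.elim0 : DefTuple S (fun (_ : α → RV v) (i : Fin 0) => (i.elim0 : RV v)) :=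
  fun i => i.elim0

lemma DefTuple.coord (e : β → α) : DefTuple S (fun t : α → RV v => fun b => t (e b)) :=
  fun b => DefTerm.proj (e b)

lemma DefFam.comp [Finite α] [Finite β] {h : T → α → RV v} (hh : DefFam S h)
    {g : (α → RV v) → β → RV v} (hg : DefTuple S g) : DefFam S (fun t => g (h t)) := by
  have h1 : RVDef S {z : β ⊕ α → RV v | (fun a => z (Sum.inr a)) ∈ Set.range h} :=
    hh.preimage Sum.inr
  have h2 : RVDef S (⋂ b : β, {z : β ⊕ α → RV v | z (Sum.inl b) = g (z ∘ Sum.inr) b}) := by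
    have := Fintype.ofFinite β
    choose E hE hD using fun b => hg b (Sum.inr : α → β ⊕ α) (Sum.inl b)
    refine ⟨_, Set.definable_iInter_of_finite hE, ?_⟩
    ext t
    simp only [hD, Set.mem_iInter, Set.mem_ofPred_eq]
  have h3 := (h1.inter h2).exists
  unfold DefFam
  convert h3 using 1
  ext w
  simp only [Set.mem_range, Set.mem_ofPred_eq, Set.mem_inter_iff, Set.mem_iInter, Sum.elim_inl,
    Sum.elim_inr]
  constructor
  · rintro ⟨t, rfl⟩
    exact ⟨h t, ⟨t, rfl⟩, fun b => rfl⟩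
  · rintro ⟨s, ⟨t, ht⟩, hs⟩
    refine ⟨t, ?_⟩
    funext b
    rw [hs b, ht]
    rfl

lemma DefFam.sum {h : T ⊕ T' → α → RV v} (h1 : DefFam S (fun t => h (Sum.inl t)))
    (h2 : DefFam S (fun t => h (Sum.inr t))) : DefFam S h := by
  unfold DefFam at *
  convert h1.union h2 using 1
  ext w
  simp

lemma DefFam.prod {h : T → α → RV v} {h' : T' → β → RV v} (h1 : DefFam S h) (h2 : DefFam S h') :
    DefFam S (fun p : T × T' => Sum.elim (h p.1) (h' p.2)) := by
  unfold DefFam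
  convert (h1.preimage (Sum.inl : α → α ⊕ β)).inter (h2.preimage (Sum.inr : β → α ⊕ β)) using 1
  ext w
  simp only [Set.mem_range, Prod.exists, Set.mem_inter_iff, Set.mem_ofPred_eq]
  constructor
  · rintro ⟨a, b, rfl⟩
    exact ⟨⟨a, rfl⟩, ⟨b, rfl⟩⟩
  · rintro ⟨⟨a, ha⟩, ⟨b, hb⟩⟩
    refine ⟨a, b, ?_⟩
    rw [ha, hb]
    funext i; cases i <;> rfl

lemma DefFam.equiv {h : T → α → RV v} (e : T' ≃ T) (h1 : DefFam S (fun t => h (e t))) :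
    DefFam S h := by
  unfold DefFam at *
  convert h1 using 1
  exact (e.surjective.range_comp h).symm

lemma DefFam.ofIsEmpty [IsEmpty T] (h : T → α → RV v) : DefFam S h := by
  unfold DefFam
  rw [Set.range_eq_empty]
  exact RVDef.empty

end Families

/-! ### The categories `RV[k, ·]` -/

section Objects

variable {K : Type u} [Field K] {Γ₀ : Type w} [LinearOrderedCommGroupWithZero Γ₀]
  {v : Valuation K Γ₀} {S : Set (Elem v)} {k l : ℕ}

/-- The weight of a tuple: the number of its coordinates that differ from `∞`. -/
def weight {n : ℕ} (t : Fin n → RV v) : ℕ := {i | t i ≠ rvInf v}.ncard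

/-- An object `(U, f)` of `RV[k, ·]`: an `S`-definable subset `U` of some power of `RV` with an
`S`-definable function `f : U → RV^k`. -/
structure RVObj (S : Set (Elem v)) (k : ℕ) : Type u where
  /-- The number of coordinates of the ambient power of `RV`. -/
  dim : ℕ
  /-- The set `U`. -/
  carrier : Set (Fin dim → RV v)
  /-- The function `f`. -/
  map : carrier → Fin k → RV v
  carrier_def : RVDef S carrier
  map_def : RVDef S (Set.range fun u : carrier => Sum.elim u.1 (map u))

/-- The morphisms of `RV[k, ·]`: definable volumetric functions `F : U → U'` such that, for every
`t` in the range of `f`, the set `(f' ∘ F)(f⁻¹(t))` is finite. -/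
structure IsMorphism (X Y : RVObj S k) (F : X.carrier → Y.carrier) : Prop where
  graph_def : RVDef S (Set.range fun u => Sum.elim u.1 (F u).1)
  volumetric : ∀ u, weight (X.map u) ≤ weight (Y.map (F u))
  finite : ∀ t ∈ Set.range X.map, ((fun u => Y.map (F u)) '' (X.map ⁻¹' {t})).Finite

/-- Two objects are isomorphic if there are mutually inverse morphisms between them. -/
def Isomorphic (X Y : RVObj S k) : Prop :=
  ∃ F : X.carrier ≃ Y.carrier, IsMorphism X Y F ∧ IsMorphism Y X F.symm

lemma IsMorphism.comp {X Y Z : RVObj S k} {F : X.carrier → Y.carrier} {G : Y.carrier → Z.carrier}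
    (hF : IsMorphism X Y F) (hG : IsMorphism Y Z G) : IsMorphism X Z (G ∘ F) where
  graph_def := by
    have h1 := hF.graph_def.preimage (β := (Fin X.dim ⊕ Fin Z.dim) ⊕ Fin Y.dim)
      (Sum.elim (fun i => Sum.inl (Sum.inl i)) Sum.inr)
    have h2 := hG.graph_def.preimage (β := (Fin X.dim ⊕ Fin Z.dim) ⊕ Fin Y.dim)
      (Sum.elim Sum.inr (fun i => Sum.inl (Sum.inr i)))
    convert (h1.inter h2).exists using 1
    ext z
    simp only [Set.mem_range, Set.mem_inter_iff, Set.mem_ofPred_eq, Function.comp_apply]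
    constructor
    · rintro ⟨u, rfl⟩
      refine ⟨(F u).1, ⟨u, ?_⟩, ⟨F u, ?_⟩⟩ <;> · funext i; cases i <;> rfl
    · rintro ⟨s, ⟨a, ha⟩, ⟨b, hb⟩⟩
      have h3 : F a = b := by
        apply Subtype.ext
        funext i
        have e1 := congrFun ha (Sum.inr i)
        have e2 := congrFun hb (Sum.inl i)
        simp at e1 e2
        rw [e1, e2]
      subst h3
      refine ⟨a, ?_⟩
      funext i
      rcases i with i | i
      · simpa using congrFun ha (Sum.inl i)
      · simpa using congrFun hb (Sum.inr i)
  volumetric u := (hF.volumetric u).trans (hG.volumetric _)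
  finite t ht := by
    refine ((hF.finite t ht).biUnion (t := fun s => (fun u => Z.map (G u)) '' (Y.map ⁻¹' {s}))
      ?_).subset ?_
    · rintro _ ⟨u, _, rfl⟩
      exact hG.finite _ ⟨_, rfl⟩
    · rintro _ ⟨u, hu, rfl⟩
      exact Set.mem_biUnion ⟨u, hu, rfl⟩ ⟨F u, rfl, rfl⟩

lemma weight_comp_equiv {n m : ℕ} (σ : Fin n ≃ Fin m) (t : Fin m → RV v) :
    weight (t ∘ σ) = weight t := by
  unfold weight
  have : {i | t i ≠ rvInf v} = σ '' {i | (t ∘ σ) i ≠ rvInf v} := by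
    ext i
    simp only [Set.mem_image, Set.mem_ofPred_eq, Function.comp_apply]
    exact ⟨fun h => ⟨σ.symm i, by simpa using h, by simp⟩, by rintro ⟨j, h, rfl⟩; exact h⟩
  rw [this, Set.ncard_image_of_injective _ σ.injective]

/-- Two objects that are parametrised by the same set, compatibly with the maps to `RV^k` up to a
permutation of coordinates, are isomorphic. -/
lemma Isomorphic.ofParam {T : Type*} {X Y : RVObj S k} (a : T ≃ X.carrier) (b : T ≃ Y.carrier)
    (σ : Fin k ≃ Fin k) (hd : DefFam S (fun t => Sum.elim (a t).1 (b t).1))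
    (hm : ∀ t i, X.map (a t) i = Y.map (b t) (σ i)) : Isomorphic X Y := by
  have main : ∀ {X Y : RVObj S k} (a : T ≃ X.carrier) (b : T ≃ Y.carrier)
      (σ : Fin k ≃ Fin k) (_ : DefFam S (fun t => Sum.elim (a t).1 (b t).1))
      (_ : ∀ t i, X.map (a t) i = Y.map (b t) (σ i)), IsMorphism X Y (a.symm.trans b) := by
    intro X Y a b σ hd hm
    have hm' : ∀ u, X.map u = Y.map (b (a.symm u)) ∘ σ := by
      intro u; funext i; simpa using hm (a.symm u) i
    refine ⟨DefFam.equiv a (by simpa using hd), fun u => ?_, fun t _ => ?_⟩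
    · rw [hm', weight_comp_equiv]; rfl
    · refine (Set.finite_singleton (t ∘ σ.symm)).subset ?_
      rintro _ ⟨u, hu, rfl⟩
      simp only [Set.mem_preimage, Set.mem_singleton_iff] at hu
      subst hu
      rw [hm']
      funext i
      simp
  refine ⟨a.symm.trans b, main a b σ hd hm, main b a σ.symm ?_ ?_⟩
  · have := hd.comp (DefTuple.coord (S := S) (v := v)
      (Sum.swap : Fin Y.dim ⊕ Fin X.dim → Fin X.dim ⊕ Fin Y.dim))
    convert this using 2 with t
    funext i; cases i <;> rfl
  · intro t i; simp [hm]

lemma Isomorphic.refl (X : RVObj S k) : Isomorphic X X := by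
  refine Isomorphic.ofParam (Equiv.refl _) (Equiv.refl _) (Equiv.refl _) ?_ (fun _ _ => rfl)
  exact DefFam.comp (h := fun u : X.carrier => Sum.elim u.1 (X.map u)) X.map_def
    ((DefTuple.coord Sum.inl).sum (DefTuple.coord Sum.inl))

lemma Isomorphic.symm {X Y : RVObj S k} : Isomorphic X Y → Isomorphic Y X :=
  fun ⟨F, h1, h2⟩ => ⟨F.symm, h2, h1⟩

lemma Isomorphic.trans {X Y Z : RVObj S k} : Isomorphic X Y → Isomorphic Y Z → Isomorphic X Z :=
  fun ⟨F, h1, h2⟩ ⟨G, h3, h4⟩ => ⟨F.trans G, h1.comp h3, h4.comp h2⟩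

/-- The object whose underlying set is the image of the injective family `code : T → RV^m`, with
`code t` mapped to `val t`. -/
def RVObj.ofCode {T : Type*} {m : ℕ} (code : T → Fin m → RV v) (hc : Function.Injective code)
    (val : T → Fin k → RV v) (hd : DefFam S (fun t => Sum.elim (code t) (val t))) : RVObj S k where
  dim := m
  carrier := Set.range code
  map := fun u => val ((Equiv.ofInjective code hc).symm u)
  carrier_def := hd.comp (DefTuple.coord Sum.inl)
  map_def := DefFam.equiv (S := S) (Equiv.ofInjective code hc) (by simpa using hd)

/-- The subobject of `(U, f)` with underlying set `U ∩ C`. -/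
def RVObj.restrict (X : RVObj S k) (C : Set (Fin X.dim → RV v)) (hC : RVDef S C) : RVObj S k where
  dim := X.dim
  carrier := X.carrier ∩ C
  map := fun u => X.map ⟨u.1, u.2.1⟩
  carrier_def := X.carrier_def.inter hC
  map_def := by
    convert X.map_def.inter (hC.preimage Sum.inl) using 1
    ext z
    simp only [Set.mem_range, Set.mem_inter_iff, Set.mem_ofPred_eq]
    constructor
    · rintro ⟨u, rfl⟩
      exact ⟨⟨⟨u.1, u.2.1⟩, rfl⟩, u.2.2⟩
    · rintro ⟨⟨u, rfl⟩, h⟩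
      exact ⟨⟨u.1, u.2, h⟩, rfl⟩

/-- The code of the first summand in a disjoint union: pad with the definable elements `1`. -/
def inlCode {m n : ℕ} (x : Fin m → RV v) : Fin (m + n + 1) → RV v :=
  Fin.append (Fin.append x (fun _ : Fin n => 1)) (fun _ : Fin 1 => 1)

/-- The code of the second summand in a disjoint union: pad with the definable elements `1` and
mark with `∞`. -/
def inrCode {m n : ℕ} (y : Fin n → RV v) : Fin (m + n + 1) → RV v :=
  Fin.append (Fin.append (fun _ : Fin m => 1) y) (fun _ : Fin 1 => rvInf v)

lemma inlCode_injective {m n : ℕ} : Function.Injective (inlCode (v := v) (m := m) (n := n)) := by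
  intro x y h
  funext i
  simpa [inlCode] using congrFun h (Fin.castAdd 1 (Fin.castAdd n i))

lemma inrCode_injective {m n : ℕ} : Function.Injective (inrCode (v := v) (m := m) (n := n)) := by
  intro x y h
  funext i
  simpa [inrCode] using congrFun h (Fin.castAdd 1 (Fin.natAdd m i))

lemma inlCode_ne_inrCode {m n : ℕ} (x : Fin m → RV v) (y : Fin n → RV v) :
    inlCode x ≠ inrCode y := by
  intro h
  have h1 := congrFun h (Fin.natAdd (m + n) 0)
  simp only [inlCode, inrCode, Fin.append_right] at h1
  exact one_ne_zero h1

lemma DefTuple.inlCode {α : Type} {m n : ℕ} {g : (α → RV v) → Fin m → RV v} (hg : DefTuple S g) :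
    DefTuple S (fun t => inlCode (n := n) (g t)) := (hg.append DefTuple.one).append DefTuple.one

lemma DefTuple.inrCode {α : Type} {m n : ℕ} {g : (α → RV v) → Fin n → RV v} (hg : DefTuple S g) :
    DefTuple S (fun t => inrCode (m := m) (g t)) := (DefTuple.one.append hg).append DefTuple.inf

lemma RVObj.fam (X : RVObj S k) : DefFam S (fun u : X.carrier => Sum.elim u.1 (X.map u)) := X.map_def

lemma RVObj.fam' (X : RVObj S k) : DefFam S (fun u : X.carrier => u.1) :=
  X.fam.comp (DefTuple.coord Sum.inl)

/-- The disjoint union `(U ⊎ U', f ⊎ f')` of two objects of `RV[k, ·]`. -/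
def RVObj.sum (X Y : RVObj S k) : RVObj S k :=
  RVObj.ofCode (T := X.carrier ⊕ Y.carrier)
    (Sum.elim (fun x => inlCode x.1) (fun y => inrCode y.1))
    (by
      rintro (x | x) (y | y) h
      · exact congrArg _ (Subtype.ext (inlCode_injective h))
      · exact absurd h (inlCode_ne_inrCode _ _)
      · exact absurd h.symm (inlCode_ne_inrCode _ _)
      · exact congrArg _ (Subtype.ext (inrCode_injective h)))
    (Sum.elim X.map Y.map)
    (DefFam.sum
      (X.fam.comp ((DefTuple.coord Sum.inl).inlCode.sum (DefTuple.coord Sum.inr)))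
      (Y.fam.comp ((DefTuple.coord Sum.inl).inrCode.sum (DefTuple.coord Sum.inr))))

/-- The product `(U × U', f × f')` of an object of `RV[k, ·]` and an object of `RV[l, ·]`, an object
of `RV[k + l, ·]`. Since tuples in `RV^0` have no coordinates, this is also the adjusted product
`(U, f) ⊠ (X, g) = (U × X, g^*)` if `k = 0` or `l = 0`. -/
def RVObj.prod (X : RVObj S k) (Y : RVObj S l) : RVObj S (k + l) :=
  RVObj.ofCode (T := X.carrier × Y.carrier)
    (fun p => Fin.append p.1.1 p.2.1)
    (by
      rintro ⟨x, y⟩ ⟨x', y'⟩ h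
      refine Prod.ext (Subtype.ext (funext fun i => ?_)) (Subtype.ext (funext fun i => ?_))
      · simpa using congrFun h (Fin.castAdd _ i)
      · simpa using congrFun h (Fin.natAdd _ i))
    (fun p => Fin.append (X.map p.1) (Y.map p.2))
    ((X.fam.prod Y.fam).comp
      (((DefTuple.coord fun i => Sum.inl (Sum.inl i)).append
          (DefTuple.coord fun i => Sum.inr (Sum.inl i))).sum
        ((DefTuple.coord fun i => Sum.inl (Sum.inr i)).append
          (DefTuple.coord fun i => Sum.inr (Sum.inr i)))))

/-- The empty object of `RV[k, ·]`. -/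
def RVObj.empty (S : Set (Elem v)) (k : ℕ) : RVObj S k :=
  RVObj.ofCode (T := Empty) (m := 0) (fun t => t.elim) (fun t => t.elim) (fun t => t.elim)
    (DefFam.ofIsEmpty _)

/-- The one-point object of `RV[0, ·]`. -/
def RVObj.point (S : Set (Elem v)) : RVObj S 0 :=
  RVObj.ofCode (T := Unit) (m := 0) (fun _ i => i.elim0) (fun _ _ _ => rfl) (fun _ i => i.elim0)
    (by
      unfold DefFam
      convert RVDef.univ (S := S) (v := v)
      ext z
      simp only [Set.mem_range, Set.mem_univ, iff_true]
      exact ⟨(), by funext i; rcases i with i | i <;> exact i.elim0⟩)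

/-! ### Grothendieck semigroups and the Grothendieck semiring -/

/-- The parametrisation of the underlying set of `RVObj.ofCode`. -/
def ofCodeEquiv {T : Type*} {m : ℕ} (code : T → Fin m → RV v) (hc : Function.Injective code)
    (val : T → Fin k → RV v) (hd : DefFam S (fun t => Sum.elim (code t) (val t))) :
    T ≃ (RVObj.ofCode code hc val hd).carrier := Equiv.ofInjective code hc

lemma map_ofCodeEquiv {T : Type*} {m : ℕ} (code : T → Fin m → RV v) (hc : Function.Injective code)
    (val : T → Fin k → RV v) (hd : DefFam S (fun t => Sum.elim (code t) (val t))) (t : T) :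
    (RVObj.ofCode code hc val hd).map (ofCodeEquiv code hc val hd t) = val t :=
  congrArg val ((Equiv.ofInjective code hc).symm_apply_apply t)

/-- The canonical parametrisation of the underlying set of a disjoint union. -/
def sumEquiv (X Y : RVObj S k) : X.carrier ⊕ Y.carrier ≃ (X.sum Y).carrier := ofCodeEquiv _ _ _ _

/-- The canonical parametrisation of the underlying set of a product. -/
def prodEquiv (X : RVObj S k) (Y : RVObj S l) : X.carrier × Y.carrier ≃ (X.prod Y).carrier :=
  ofCodeEquiv _ _ _ _

@[simp] lemma sumEquiv_inl (X Y : RVObj S k) (x : X.carrier) :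
    (sumEquiv X Y (Sum.inl x)).1 = inlCode x.1 := rfl

@[simp] lemma sumEquiv_inr (X Y : RVObj S k) (y : Y.carrier) :
    (sumEquiv X Y (Sum.inr y)).1 = inrCode y.1 := rfl

@[simp] lemma prodEquiv_val (X : RVObj S k) (Y : RVObj S l) (p : X.carrier × Y.carrier) :
    (prodEquiv X Y p).1 = Fin.append p.1.1 p.2.1 := rfl

@[simp] lemma map_sumEquiv (X Y : RVObj S k) (t : X.carrier ⊕ Y.carrier) :
    (X.sum Y).map (sumEquiv X Y t) = Sum.elim X.map Y.map t := map_ofCodeEquiv _ _ _ _ t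

@[simp] lemma map_prodEquiv (X : RVObj S k) (Y : RVObj S l) (p : X.carrier × Y.carrier) :
    (X.prod Y).map (prodEquiv X Y p) = Fin.append (X.map p.1) (Y.map p.2) :=
  map_ofCodeEquiv _ _ _ _ p

instance isEmpty_empty : IsEmpty (RVObj.empty S k).carrier :=
  (ofCodeEquiv (S := S) (v := v) (k := k) (T := Empty) (m := 0) _ _ _ _).symm.isEmpty

/-- The canonical parametrisation of the underlying set of the one-point object. -/
def pointEquiv (S : Set (Elem v)) : Unit ≃ (RVObj.point S).carrier := ofCodeEquiv _ _ _ _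

lemma weight_append {n m : ℕ} (s : Fin n → RV v) (t : Fin m → RV v) :
    weight (Fin.append s t) = weight s + weight t := by
  classical
  unfold weight
  have h : {i | Fin.append s t i ≠ rvInf v} =
      (Fin.castAdd m '' {i | s i ≠ rvInf v}) ∪ (Fin.natAdd n '' {i | t i ≠ rvInf v}) := by
    ext i
    refine Fin.addCases (fun i => ?_) (fun i => ?_) i
    · have : ∀ x, Fin.natAdd n x ≠ Fin.castAdd m i := by
        intro x hx; have := congrArg Fin.val hx; simp at this; omega
      simp [this]
    · have : ∀ x, Fin.castAdd m x ≠ Fin.natAdd n i := by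
        intro x hx; have := congrArg Fin.val hx; simp at this; omega
      simp [this]
  rw [h, Set.ncard_union_eq, Set.ncard_image_of_injective _ (Fin.castAdd_injective n m),
    Set.ncard_image_of_injective _ (Fin.natAdd_injective m n)]
  rw [Set.disjoint_left]
  rintro _ ⟨a, _, rfl⟩ ⟨b, _, hb⟩
  have := congrArg Fin.val hb; simp at this; omega

lemma IsMorphism.sum {X X' Y Y' : RVObj S k} {F : X.carrier ≃ X'.carrier}
    {G : Y.carrier ≃ Y'.carrier} (hF : IsMorphism X X' F) (hG : IsMorphism Y Y' G) :
    IsMorphism (X.sum Y) (X'.sum Y')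
      ((sumEquiv X Y).symm.trans ((Equiv.sumCongr F G).trans (sumEquiv X' Y'))) where
  graph_def := by
    refine DefFam.equiv (S := S) (sumEquiv X Y) (DefFam.sum ?_ ?_)
    · simp only [Equiv.trans_apply, Equiv.symm_apply_apply, Equiv.sumCongr_apply, Sum.map_inl,
        sumEquiv_inl]
      exact DefFam.comp (h := fun u : X.carrier => Sum.elim u.1 (F u).1) hF.graph_def
        ((DefTuple.coord Sum.inl).inlCode.sum (DefTuple.coord Sum.inr).inlCode)
    · simp only [Equiv.trans_apply, Equiv.symm_apply_apply, Equiv.sumCongr_apply, Sum.map_inr,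
        sumEquiv_inr]
      exact DefFam.comp (h := fun u : Y.carrier => Sum.elim u.1 (G u).1) hG.graph_def
        ((DefTuple.coord Sum.inl).inrCode.sum (DefTuple.coord Sum.inr).inrCode)
  volumetric u := by
    obtain ⟨t, rfl⟩ := (sumEquiv X Y).surjective u
    rcases t with t | t
    · simpa using hF.volumetric t
    · simpa using hG.volumetric t
  finite t _ := by
    have h1 : ((fun u => X'.map (F u)) '' (X.map ⁻¹' {t})).Finite := by
      by_cases h : t ∈ Set.range X.map
      · exact hF.finite t h
      · rw [Set.preimage_singleton_eq_empty.2 h]; simp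
    have h2 : ((fun u => Y'.map (G u)) '' (Y.map ⁻¹' {t})).Finite := by
      by_cases h : t ∈ Set.range Y.map
      · exact hG.finite t h
      · rw [Set.preimage_singleton_eq_empty.2 h]; simp
    refine (h1.union h2).subset ?_
    rintro _ ⟨u, hu, rfl⟩
    obtain ⟨p, rfl⟩ := (sumEquiv X Y).surjective u
    rcases p with p | p
    · left; exact ⟨p, by simpa using hu, by simp⟩
    · right; exact ⟨p, by simpa using hu, by simp⟩

lemma Isomorphic.sum {X X' Y Y' : RVObj S k} :
    Isomorphic X X' → Isomorphic Y Y' → Isomorphic (X.sum Y) (X'.sum Y') :=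
  fun ⟨_, h1, h2⟩ ⟨_, h3, h4⟩ => ⟨_, h1.sum h3, h2.sum h4⟩

lemma IsMorphism.prod {X X' : RVObj S k} {Y Y' : RVObj S l} {F : X.carrier ≃ X'.carrier}
    {G : Y.carrier ≃ Y'.carrier} (hF : IsMorphism X X' F) (hG : IsMorphism Y Y' G) :
    IsMorphism (X.prod Y) (X'.prod Y')
      ((prodEquiv X Y).symm.trans ((Equiv.prodCongr F G).trans (prodEquiv X' Y'))) where
  graph_def := by
    refine DefFam.equiv (S := S) (prodEquiv X Y) ?_
    simp only [Equiv.trans_apply, Equiv.symm_apply_apply, Equiv.prodCongr_apply, Prod.map,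
      prodEquiv_val]
    exact (DefFam.prod (S := S) (h := fun u : X.carrier => Sum.elim u.1 (F u).1) (h' := fun u : Y.carrier => Sum.elim u.1 (G u).1)
      hF.graph_def hG.graph_def).comp
        (((DefTuple.coord fun i => Sum.inl (Sum.inl i)).append
          (DefTuple.coord fun i => Sum.inr (Sum.inl i))).sum
        ((DefTuple.coord fun i => Sum.inl (Sum.inr i)).append
          (DefTuple.coord fun i => Sum.inr (Sum.inr i))))
  volumetric u := by
    obtain ⟨t, rfl⟩ := (prodEquiv X Y).surjective u
    simpa [weight_append] using add_le_add (hF.volumetric t.1) (hG.volumetric t.2)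
  finite t ht := by
    obtain ⟨u, rfl⟩ := ht
    obtain ⟨p, rfl⟩ := (prodEquiv X Y).surjective u
    refine ((hF.finite (X.map p.1) ⟨_, rfl⟩).image2 Fin.append
      (hG.finite (Y.map p.2) ⟨_, rfl⟩)).subset ?_
    rintro _ ⟨u, hu, rfl⟩
    obtain ⟨q, rfl⟩ := (prodEquiv X Y).surjective u
    simp only [Set.mem_preimage, map_prodEquiv, Set.mem_singleton_iff] at hu
    refine ⟨_, ⟨q.1, ?_, rfl⟩, _, ⟨q.2, ?_, rfl⟩, by simp⟩
    · funext i; simpa using congrFun hu (Fin.castAdd _ i)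
    · funext i; simpa using congrFun hu (Fin.natAdd _ i)

lemma Isomorphic.prod {X X' : RVObj S k} {Y Y' : RVObj S l} :
    Isomorphic X X' → Isomorphic Y Y' → Isomorphic (X.prod Y) (X'.prod Y') :=
  fun ⟨_, h1, h2⟩ ⟨_, h3, h4⟩ => ⟨_, h1.prod h3, h2.prod h4⟩

/-- Isomorphism of objects of `RV[k, ·]` as an equivalence relation. -/
instance isoSetoid (S : Set (Elem v)) (k : ℕ) : Setoid (RVObj S k) :=
  ⟨Isomorphic, Isomorphic.refl, Isomorphic.symm, Isomorphic.trans⟩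

/-- The Grothendieck semigroup of `RV[k, ·]`: the isomorphism classes of objects, with addition
`[X] + [Y] = [X ⊎ Y]`. -/
def Gsk (S : Set (Elem v)) (k : ℕ) : Type u := Quotient (isoSetoid S k)

/-- The isomorphism class of an object. -/
def RVObj.cls (X : RVObj S k) : Gsk S k := Quotient.mk _ X

instance : Add (Gsk S k) := ⟨Quotient.map₂ RVObj.sum (fun _ _ h1 _ _ h2 => Isomorphic.sum h1 h2)⟩

instance : Zero (Gsk S k) := ⟨(RVObj.empty S k).cls⟩

lemma sum_comm_iso (X Y : RVObj S k) : Isomorphic (X.sum Y) (Y.sum X) := by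
  refine Isomorphic.ofParam (sumEquiv X Y) ((Equiv.sumComm _ _).trans (sumEquiv Y X))
    (Equiv.refl _) (DefFam.sum ?_ ?_) ?_
  · exact X.fam'.comp ((DefTuple.coord id).inlCode.sum (DefTuple.coord id).inrCode)
  · exact Y.fam'.comp ((DefTuple.coord id).inrCode.sum (DefTuple.coord id).inlCode)
  · rintro (t | t) i <;> simp

lemma sum_assoc_iso (X Y Z : RVObj S k) :
    Isomorphic ((X.sum Y).sum Z) (X.sum (Y.sum Z)) := by
  refine Isomorphic.ofParam
    ((Equiv.sumCongr (sumEquiv X Y) (Equiv.refl _)).trans (sumEquiv (X.sum Y) Z))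
    ((Equiv.sumAssoc _ _ _).trans
      ((Equiv.sumCongr (Equiv.refl _) (sumEquiv Y Z)).trans (sumEquiv X (Y.sum Z))))
    (Equiv.refl _) (DefFam.sum (DefFam.sum ?_ ?_) ?_) ?_
  · exact X.fam'.comp ((DefTuple.coord id).inlCode.inlCode.sum (DefTuple.coord id).inlCode)
  · exact Y.fam'.comp ((DefTuple.coord id).inrCode.inlCode.sum (DefTuple.coord id).inlCode.inrCode)
  · exact Z.fam'.comp ((DefTuple.coord id).inrCode.sum (DefTuple.coord id).inrCode.inrCode)
  · rintro ((t | t) | t) i <;> simp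

lemma sum_empty_iso (X : RVObj S k) : Isomorphic (X.sum (RVObj.empty S k)) X := by
  refine Isomorphic.ofParam (sumEquiv _ _) (Equiv.sumEmpty _ _)
    (Equiv.refl _) (DefFam.sum ?_ (DefFam.ofIsEmpty _)) ?_
  · exact X.fam'.comp ((DefTuple.coord id).inlCode.sum (DefTuple.coord id))
  · rintro (t | t) i
    · simp
    · exact isEmptyElim t

instance : AddCommMonoid (Gsk S k) where
  add_assoc := by
    rintro ⟨X⟩ ⟨Y⟩ ⟨Z⟩; exact Quotient.sound (sum_assoc_iso X Y Z)
  zero_add := by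
    rintro ⟨X⟩; exact Quotient.sound ((sum_comm_iso _ _).trans (sum_empty_iso X))
  add_zero := by
    rintro ⟨X⟩; exact Quotient.sound (sum_empty_iso X)
  add_comm := by
    rintro ⟨X⟩ ⟨Y⟩; exact Quotient.sound (sum_comm_iso X Y)
  nsmul := nsmulRec

lemma empty_iso {X Y : RVObj S k} [IsEmpty X.carrier] [IsEmpty Y.carrier] : Isomorphic X Y :=
  Isomorphic.ofParam (T := Empty) (Equiv.equivOfIsEmpty _ _) (Equiv.equivOfIsEmpty _ _)
    (Equiv.refl _) (DefFam.ofIsEmpty _) (fun t => t.elim)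

lemma prod_sum_iso (X : RVObj S k) (Y Z : RVObj S l) :
    Isomorphic (X.prod (Y.sum Z)) ((X.prod Y).sum (X.prod Z)) := by
  refine Isomorphic.ofParam
    ((Equiv.prodSumDistrib _ _ _).symm.trans
      ((Equiv.prodCongr (Equiv.refl _) (sumEquiv Y Z)).trans (prodEquiv X (Y.sum Z))))
    ((Equiv.sumCongr (prodEquiv X Y) (prodEquiv X Z)).trans (sumEquiv _ _))
    (Equiv.refl _) (DefFam.sum ?_ ?_) ?_
  · exact (X.fam'.prod Y.fam').comp
      (((DefTuple.coord Sum.inl).append (DefTuple.coord Sum.inr).inlCode).sum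
        ((DefTuple.coord Sum.inl).append (DefTuple.coord Sum.inr)).inlCode)
  · exact (X.fam'.prod Z.fam').comp
      (((DefTuple.coord Sum.inl).append (DefTuple.coord Sum.inr).inrCode).sum
        ((DefTuple.coord Sum.inl).append (DefTuple.coord Sum.inr)).inrCode)
  · rintro (t | t) i <;> simp

lemma sum_prod_iso (X Y : RVObj S k) (Z : RVObj S l) :
    Isomorphic ((X.sum Y).prod Z) ((X.prod Z).sum (Y.prod Z)) := by
  refine Isomorphic.ofParam
    ((Equiv.sumProdDistrib _ _ _).symm.trans
      ((Equiv.prodCongr (sumEquiv X Y) (Equiv.refl _)).trans (prodEquiv (X.sum Y) Z)))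
    ((Equiv.sumCongr (prodEquiv X Z) (prodEquiv Y Z)).trans (sumEquiv _ _))
    (Equiv.refl _) (DefFam.sum ?_ ?_) ?_
  · exact (X.fam'.prod Z.fam').comp
      (((DefTuple.coord Sum.inl).inlCode.append (DefTuple.coord Sum.inr)).sum
        ((DefTuple.coord Sum.inl).append (DefTuple.coord Sum.inr)).inlCode)
  · exact (Y.fam'.prod Z.fam').comp
      (((DefTuple.coord Sum.inl).inrCode.append (DefTuple.coord Sum.inr)).sum
        ((DefTuple.coord Sum.inl).append (DefTuple.coord Sum.inr)).inrCode)
  · rintro (t | t) i <;> simp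

/-- The multiplication of isomorphism classes, `[X][Y] = [X × Y]`. -/
instance : GradedMonoid.GMul (Gsk S) where
  mul := Quotient.map₂ RVObj.prod (fun _ _ h1 _ _ h2 => Isomorphic.prod h1 h2)

/-- The multiplicative identity is the class of the one-point object of `RV[0, ·]`. -/
instance : GradedMonoid.GOne (Gsk S) where
  one := (RVObj.point S).cls

/-- A graded version of `Isomorphic.ofParam`. -/
lemma graded_eq {T : Type*} {X : RVObj S k} {Y : RVObj S l} (h : k = l) (a : T ≃ X.carrier)
    (b : T ≃ Y.carrier) (σ : Fin k ≃ Fin l) (hd : DefFam S (fun t => Sum.elim (a t).1 (b t).1))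
    (hm : ∀ t i, X.map (a t) i = Y.map (b t) (σ i)) :
    (GradedMonoid.mk k X.cls : GradedMonoid (Gsk S)) = GradedMonoid.mk l Y.cls := by
  subst h
  exact congrArg (GradedMonoid.mk k) (Quotient.sound (Isomorphic.ofParam a b σ hd hm))

instance : DirectSum.GCommSemiring (Gsk S) where
  mul_zero := by
    rintro i j ⟨X⟩
    have : IsEmpty (X.prod (RVObj.empty S j)).carrier := (prodEquiv _ _).symm.isEmpty
    exact Quotient.sound empty_iso
  zero_mul := by
    rintro i j ⟨X⟩
    have : IsEmpty ((RVObj.empty S i).prod X).carrier := (prodEquiv _ _).symm.isEmpty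
    exact Quotient.sound empty_iso
  mul_add := by
    rintro i j ⟨X⟩ ⟨Y⟩ ⟨Z⟩
    exact Quotient.sound (prod_sum_iso X Y Z)
  add_mul := by
    rintro i j ⟨X⟩ ⟨Y⟩ ⟨Z⟩
    exact Quotient.sound (sum_prod_iso X Y Z)
  one_mul := by
    rintro ⟨i, ⟨X⟩⟩
    refine graded_eq (T := Unit × X.carrier) (X := (RVObj.point S).prod X) (Y := X) (zero_add i)
      ((Equiv.prodCongr (pointEquiv S) (Equiv.refl _)).trans (prodEquiv _ _))
      (Equiv.punitProd _) (finCongr (zero_add i)) ?_ ?_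
    · refine DefFam.equiv (Equiv.punitProd _).symm ?_
      exact X.fam'.comp ((DefTuple.elim0.append (DefTuple.coord id)).sum
        (DefTuple.coord id))
    · rintro ⟨_, t⟩ j
      refine Fin.addCases (fun j => j.elim0) (fun j => ?_) j
      have hj : Fin.cast (zero_add i) (Fin.natAdd 0 j) = j := Fin.ext (by simp)
      simp only [Equiv.trans_apply, Equiv.prodCongr_apply, Prod.map, map_prodEquiv,
        Fin.append_right, finCongr_apply, hj]
      rfl
  mul_one := by
    rintro ⟨i, ⟨X⟩⟩
    refine graded_eq (T := X.carrier × Unit) (X := X.prod (RVObj.point S)) (Y := X) (add_zero i)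
      ((Equiv.prodCongr (Equiv.refl _) (pointEquiv S)).trans (prodEquiv _ _))
      (Equiv.prodPUnit _) (finCongr (add_zero i)) ?_ ?_
    · refine DefFam.equiv (Equiv.prodPUnit _).symm ?_
      exact X.fam'.comp (((DefTuple.coord id).append (DefTuple.elim0)).sum
        (DefTuple.coord id))
    · rintro ⟨t, _⟩ j
      refine Fin.addCases (fun j => ?_) (fun j => j.elim0) j
      simp only [Equiv.trans_apply, Equiv.prodCongr_apply, Prod.map, map_prodEquiv,
        Fin.append_left]
      rfl
  mul_assoc := by
    rintro ⟨i, ⟨X⟩⟩ ⟨j, ⟨Y⟩⟩ ⟨k, ⟨Z⟩⟩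
    refine graded_eq (X := (X.prod Y).prod Z) (Y := X.prod (Y.prod Z)) (add_assoc i j k)
      ((Equiv.prodCongr (prodEquiv X Y) (Equiv.refl _)).trans (prodEquiv (X.prod Y) Z))
      ((Equiv.prodAssoc _ _ _).trans
        ((Equiv.prodCongr (Equiv.refl _) (prodEquiv Y Z)).trans (prodEquiv X (Y.prod Z))))
      (finCongr (add_assoc i j k)) ?_ ?_
    · exact ((X.fam'.prod Y.fam').prod Z.fam').comp
        ((((DefTuple.coord fun i => Sum.inl (Sum.inl i)).append
          (DefTuple.coord fun i => Sum.inl (Sum.inr i))).append (DefTuple.coord Sum.inr)).sum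
        ((DefTuple.coord fun i => Sum.inl (Sum.inl i)).append
          ((DefTuple.coord fun i => Sum.inl (Sum.inr i)).append (DefTuple.coord Sum.inr))))
    · rintro ⟨⟨x, y⟩, z⟩ a
      simp [Fin.append_assoc]
  natCast := fun n => n • (RVObj.point S).cls
  natCast_zero := zero_nsmul _
  natCast_succ := fun n => succ_nsmul _ n
  mul_comm := by
    rintro ⟨i, ⟨X⟩⟩ ⟨j, ⟨Y⟩⟩
    refine graded_eq (X := X.prod Y) (Y := Y.prod X) (add_comm i j)
      (prodEquiv X Y) ((Equiv.prodComm _ _).trans (prodEquiv Y X))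
      finAddFlip ?_ ?_
    · exact (X.fam'.prod Y.fam').comp
        (((DefTuple.coord Sum.inl).append (DefTuple.coord Sum.inr)).sum
        ((DefTuple.coord Sum.inr).append (DefTuple.coord Sum.inl)))
    · rintro ⟨x, y⟩ a
      refine Fin.addCases (fun a => ?_) (fun a => ?_) a <;> simp

/-- The Grothendieck semiring of `RV[*, ·]`, the direct sum of the categories `RV[k, ·]`. -/
abbrev GskStar (S : Set (Elem v)) : Type u := ⨁ k, Gsk S k

/-! ### Blowups -/

/-- `(Y, f)` has an elementary blowup with respect to the `j`-th coordinate: for every `t ∈ Y` the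
element `f_j(t)` is algebraic over the other coordinates of `f(t)` and different from `∞`. -/
def RVObj.CanBlowup (Y : RVObj S k) (j : Fin k) : Prop :=
  ∀ t : Y.carrier, InAcl S {r | ∃ i, i ≠ j ∧ r = Y.map t i} (Y.map t j) ∧ Y.map t j ≠ rvInf v

/-- The object `(Y × RV^{>1}, f^♯)`, where `f^♯(t, s)` is `f(t)` with its `j`-th coordinate
multiplied by `s`. Here `RV^{>1}` contains `∞`. It is the elementary blowup of `(Y, f)` with respect
to the `j`-th coordinate if `Y.CanBlowup j`. -/
def RVObj.elemBlowup (Y : RVObj S k) (j : Fin k) : RVObj S k :=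
  RVObj.ofCode (T := Y.carrier × {s : RV v // vrv v s < 1})
    (fun p => Fin.append p.1.1 (fun _ : Fin 1 => p.2.1))
    (by
      rintro ⟨x, y⟩ ⟨x', y'⟩ h
      refine Prod.ext (Subtype.ext (funext fun i => ?_)) (Subtype.ext ?_)
      · simpa using congrFun h (Fin.castAdd _ i)
      · simpa using congrFun h (Fin.natAdd _ 0))
    (fun p => Function.update (Y.map p.1) j (p.2.1 * Y.map p.1 j))
    (by
      have h1 : DefFam S (fun (s : {s : RV v // vrv v s < 1}) (_ : Fin 1) => s.1) := by
        unfold DefFam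
        convert RVDef.gt_one (S := S) (0 : Fin 1) using 1
        ext t
        simp only [Set.mem_range, Subtype.exists, Set.mem_ofPred_eq]
        constructor
        · rintro ⟨s, hs, rfl⟩; exact hs
        · exact fun h => ⟨_, h, by funext i; rw [Subsingleton.elim i 0]⟩
      have h2 : DefTuple S (fun t : (Fin Y.dim ⊕ Fin k) ⊕ Fin 1 → RV v =>
          Function.update (fun i => t (Sum.inl (Sum.inr i))) j
            (t (Sum.inr 0) * t (Sum.inl (Sum.inr j)))) := by
        intro i
        by_cases h : i = j
        · subst h
          simpa using DefTerm.mul _ _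
        · simpa [h] using DefTerm.proj _
      exact (Y.fam.prod h1).comp (((DefTuple.coord fun i => Sum.inl (Sum.inl i)).append
        (DefTuple.coord fun i => Sum.inr i)).sum h2))

/-- `X'` is a blowup of `X`: for some definable locus `C ⊆ X`, some `(Y, f)` isomorphic to the
subobject of `X` on `C`, and an elementary blowup `(Y, f)^♯`, `X'` is the disjoint union of
`(Y, f)^♯` and the subobject of `X` on the complement of `C`. -/
def IsBlowup (X X' : RVObj S k) : Prop :=
  ∃ (C : Set (Fin X.dim → RV v)) (hC : RVDef S C) (Y : RVObj S k) (j : Fin k),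
    C ⊆ X.carrier ∧ Isomorphic Y (X.restrict C hC) ∧ Y.CanBlowup j ∧
      X' = (Y.elemBlowup j).sum (X.restrict Cᶜ hC.compl)

/-- `X'` is an iterated blowup of `X`: a composition of finitely many (possibly zero) blowups. -/
def IsIteratedBlowup : RVObj S k → RVObj S k → Prop := Relation.ReflTransGen IsBlowup

/-- The relation `isp[k, ·]` on the objects of `RV[k, ·]`: the two objects have isomorphic iterated
blowups. -/
def Isp (X Y : RVObj S k) : Prop :=
  ∃ X' Y' : RVObj S k, IsIteratedBlowup X X' ∧ IsIteratedBlowup Y Y' ∧ Isomorphic X' Y'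

/-- The relation on isomorphism classes induced by `Isp`. -/
def IspCls (a b : Gsk S k) : Prop := ∃ X Y : RVObj S k, X.cls = a ∧ Y.cls = b ∧ Isp X Y

/-- The relation `isp[*, ·]`, the direct sum of the relations `isp[k, ·]`. -/
def IspStar (x y : GskStar S) : Prop := ∀ k, IspCls (x k) (y k)

end Objects

end

end ACVF

/-! The heart of the matter is that an elementary blowup is well defined on isomorphism classes: if
`Y` and `Z` are isomorphic and can be blown up in coordinates `i` and `j`, possibly unrelated, then
the blowups are isomorphic. The isomorphism is `F × id`. The weight condition survives because
multiplying a coordinate different from `∞` by `s` changes both weights by the same amount. The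
finiteness condition is where the model theory enters. A value of the blown up map determines `f(y)`
off the coordinate `i`. Since `f_i(y)` is algebraic over those coordinates, saturation leaves only
finitely many possibilities for `f(y)` (`RVObj.CanBlowup.finite_fiber`), hence for the image of `y`
and for `s`.

The rest is algebra on classes. Objects can be cut along definable sets, so the Grothendieck
semigroup has the refinement property: two decompositions of a class have a common refinement
(`Gsk.refinement`). Elementary blowups respect decompositions and products with a fixed object. Two
blowups of one class can therefore be compared piece by piece: on the intersection of the two loci
they agree, and each can be continued on the part of the other locus that it left alone. This is the
diamond property (`BlowupCls.diamond`).

Having isomorphic iterated blowups thus means being joinable for a confluent relation on classes,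
which is an equivalence relation. Adding a class, or multiplying by one, maps blowups to blowups,
and so preserves joinability. The graded statement follows by expanding into homogeneous components.
-/

namespace ACVF

universe u w

/-! ### Model theory: saturation, algebraicity and finiteness. -/

section Saturation

open FirstOrder FirstOrder.Language

/-- In a `κ`-saturated structure, a set that is definable over fewer than `κ` parameters and all of
whose elements are algebraic over these parameters is finite. -/
theorem IsSaturated.finite_of_algebraic {L : FirstOrder.Language.{0, 0}} {M : Type u}
    [L.Structure M] {κ : Cardinal.{u}} (hsat : IsSaturated L M κ) {A : Set M} (hA : #A < κ)
    {D : Set M} (hD : A.Definable₁ L D)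
    (h : ∀ x ∈ D, ∃ E : Set M, A.Definable₁ L E ∧ E.Finite ∧ x ∈ E) : D.Finite := by
  by_contra hinf
  have hev : Function.Injective (fun x : Fin 1 → M => x 0) := (Equiv.funUnique (Fin 1) M).injective
  have hD1 : {x : Fin 1 → M | x 0 ∈ D}.Infinite := by
    intro hfin
    refine hinf ((hfin.image fun x => x 0).subset fun a ha => ⟨fun _ => a, ha, rfl⟩)
  -- The type of a generic point of `D`: all formulas that hold on `D` with finitely many
  -- exceptions. Finitely many of them have only finitely many exceptions together, and `D` is
  -- infinite, so the type is finitely satisfiable.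
  obtain ⟨x, hx⟩ := hsat A hA 1
    {ψ : L[[A]].Formula (Fin 1) | {x : Fin 1 → M | x 0 ∈ D ∧ ¬ ψ.Realize x}.Finite} (by
      intro q hq
      have hfin : (⋃ ψ ∈ q, {x : Fin 1 → M | x 0 ∈ D ∧ ¬ ψ.Realize x}).Finite :=
        q.finite_toSet.biUnion fun ψ hψ => hq hψ
      obtain ⟨x, hxD, hx⟩ := (hD1.sdiff hfin).nonempty
      refine ⟨x, fun ψ hψ => ?_⟩
      by_contra hn
      exact hx (Set.mem_biUnion (x := ψ) hψ ⟨hxD, hn⟩))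
  obtain ⟨φ, hφ⟩ := hD
  have hmem : ∀ y : Fin 1 → M, y 0 ∈ D ↔ φ.Realize y := fun y => Set.ext_iff.1 hφ y
  have hxD : x 0 ∈ D := by
    refine (hmem x).2 (hx φ ?_)
    refine Set.finite_empty.subset ?_
    rintro y ⟨h1, h2⟩
    exact h2 ((hmem y).1 h1)
  obtain ⟨E, ⟨θ, hθ⟩, hE, hxE⟩ := h _ hxD
  have hmemE : ∀ y : Fin 1 → M, y 0 ∈ E ↔ θ.Realize y := fun y => Set.ext_iff.1 hθ y
  -- The generic point lies in a finite definable set `E`. But the complement of `E` omits only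
  -- finitely many points of `D`, so its formula belongs to the type.
  refine Formula.realize_not.1 (hx θ.not ?_) ((hmemE x).1 hxE)
  refine (hE.preimage hev.injOn).subset ?_
  rintro y ⟨-, h2⟩
  rw [Formula.realize_not, not_not] at h2
  exact (hmemE y).2 h2

/-- Fixing all coordinates but one of a definable set to parameters. -/
theorem definable₁_update {L : FirstOrder.Language.{0, 0}} {M : Type u} [L.Structure M]
    {A B : Set M} (hAB : A ⊆ B) {α : Type} [DecidableEq α] {D : Set (α → M)}
    (hD : A.Definable L D) (j : α) (c : α → M) (hc : ∀ i, i ≠ j → c i ∈ B) :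
    B.Definable₁ L {x | Function.update c j x ∈ D} := by
  obtain ⟨φ, rfl⟩ := hD.mono hAB
  refine ⟨φ.subst fun i => if h : i = j then Term.var 0 else
    (L.con (⟨c i, hc i h⟩ : B)).term, ?_⟩
  ext x
  simp only [Set.mem_ofPred_eq]
  unfold Formula.Realize
  rw [BoundedFormula.realize_subst]
  refine iff_of_eq (congrArg (fun y => BoundedFormula.Realize φ y default) (funext fun i => ?_))
  by_cases h : i = j
  · subst h; simp
  · simp [h]

end Saturation

/-! ### Elementary blowups: invariance under isomorphism, and products. -/

section Blowup

variable {K : Type u} [Field K] {Γ₀ : Type w} [LinearOrderedCommGroupWithZero Γ₀]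
  {v : Valuation K Γ₀} {S : Set (Elem v)} {k l : ℕ}

/-- If `(Y, f)` can be blown up in the `j`-th coordinate, then `f_j` takes finitely many values
where the other coordinates of `f` are fixed. -/
theorem RVObj.CanBlowup.finite_fiber {κ : Cardinal.{max u w}} (hκ : ℵ₀ ≤ κ)
    (hsat : IsSaturated LRV (Elem v) κ) (hS : #S < κ) {Y : RVObj S k} {j : Fin k}
    (hY : Y.CanBlowup j) (r : Fin k → RV v) :
    {f : Fin k → RV v | f ∈ Set.range Y.map ∧ ∀ i, i ≠ j → f i = r i}.Finite := by
  have hA : {a | ∃ i, i ≠ j ∧ a = r i}.Finite :=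
    (Set.finite_range r).subset (by rintro _ ⟨i, -, rfl⟩; exact ⟨i, rfl⟩)
  -- The finitely many fixed coordinates join `S` as parameters; as `κ` is infinite, there are still
  -- fewer than `κ` of them.
  have hcard : #(S ∪ Elem.rv '' {a | ∃ i, i ≠ j ∧ a = r i} : Set (Elem v)) < κ :=
    (Cardinal.mk_union_le _ _).trans_lt
      (Cardinal.add_lt_of_lt hκ hS ((hA.image _).lt_aleph0.trans_le hκ))
  obtain ⟨E, hE, hEeq⟩ : RVDef S (Set.range Y.map) := Y.fam.comp (DefTuple.coord Sum.inr)
  have hmem : ∀ f : Fin k → RV v, f ∈ Set.range Y.map ↔ (fun i => Elem.rv (f i)) ∈ E :=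
    fun f => Set.ext_iff.1 hEeq f
  have hupd : ∀ b : RV v, Function.update (fun i => Elem.rv (r i)) j (Elem.rv b) =
      fun i => Elem.rv (Function.update r j b i) := by
    intro b; funext i
    by_cases h : i = j
    · subst h; simp
    · simp [h]
  -- Only the trace of `E` on powers of `RV` is prescribed, so the slice of `E` has to be cut down
  -- to the sort `RV`.
  have hdef := (definable₁_update (Set.subset_union_left
    (t := Elem.rv '' {a | ∃ i, i ≠ j ∧ a = r i})) hE j (fun i => Elem.rv (r i))
    fun i hi => Or.inr ⟨_, ⟨i, hi, rfl⟩, rfl⟩).inter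
      ((definable_rel (S := S) (v := v) LRel.isRV (fun _ => (0 : Fin 1))).mono
        Set.subset_union_left)
  have hfin : {x : Elem v | Function.update (fun i => Elem.rv (r i)) j x ∈ E ∧
      ∃ b, x = Elem.rv b}.Finite := by
    refine hsat.finite_of_algebraic hcard (D := {x : Elem v |
      Function.update (fun i => Elem.rv (r i)) j x ∈ E ∧ ∃ b, x = Elem.rv b}) hdef ?_
    rintro _ ⟨hx, b, rfl⟩
    rw [hupd, ← hmem] at hx
    obtain ⟨t, ht⟩ := hx
    have hY' := (hY t).1
    have e1 : {a | ∃ i, i ≠ j ∧ a = Y.map t i} = {a | ∃ i, i ≠ j ∧ a = r i} := by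
      ext a
      refine exists_congr fun i => and_congr_right fun hi => ?_
      rw [ht, Function.update_of_ne hi]
    -- The coordinates of `f(t)` other than the `j`-th are those of `r`, so algebraicity over them
    -- is algebraicity over the chosen parameters, the same for every `t`.
    rw [e1, ht, Function.update_self] at hY'
    exact hY'
  have hinj : Function.Injective (Elem.rv : RV v → Elem v) := fun a b h => by injection h
  refine ((hfin.preimage hinj.injOn).image (Function.update r j)).subset ?_
  rintro f ⟨hf, hr⟩
  have e : Function.update r j (f j) = f := by
    funext i
    by_cases h : i = j
    · subst h; simp
    · simp [h, hr i h]
  refine ⟨f j, ⟨?_, f j, rfl⟩, e⟩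
  show Function.update (fun i => Elem.rv (r i)) j (Elem.rv (f j)) ∈ E
  rw [hupd, ← hmem, e]
  exact hf

/-- The canonical parametrisation of the underlying set of an elementary blowup. -/
noncomputable def elemBlowupEquiv (Y : RVObj S k) (j : Fin k) :
    Y.carrier × {s : RV v // vrv v s < 1} ≃ (Y.elemBlowup j).carrier := ofCodeEquiv _ _ _ _

@[simp] lemma elemBlowupEquiv_val (Y : RVObj S k) (j : Fin k)
    (p : Y.carrier × {s : RV v // vrv v s < 1}) :
    (elemBlowupEquiv Y j p).1 = Fin.append p.1.1 (fun _ : Fin 1 => p.2.1) := rfl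

@[simp] lemma map_elemBlowupEquiv (Y : RVObj S k) (j : Fin k)
    (p : Y.carrier × {s : RV v // vrv v s < 1}) :
    (Y.elemBlowup j).map (elemBlowupEquiv Y j p) =
      Function.update (Y.map p.1) j (p.2.1 * Y.map p.1 j) :=
  map_ofCodeEquiv _ _ _ _ p

lemma DefFam.gt_one :
    DefFam S (fun (s : {s : RV v // vrv v s < 1}) (_ : Fin 1) => s.1) := by
  unfold DefFam
  convert RVDef.gt_one (S := S) (0 : Fin 1) using 1
  ext t
  simp only [Set.mem_range, Subtype.exists, Set.mem_ofPred_eq]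
  constructor
  · rintro ⟨s, hs, rfl⟩; exact hs
  · exact fun h => ⟨_, h, by funext i; rw [Subsingleton.elim i 0]⟩

/-- Replacing a coordinate different from `∞` lowers the weight by one exactly if the new value
is `∞`. -/
lemma weight_update_mul {n : ℕ} (f : Fin n → RV v) (j : Fin n) (hj : f j ≠ 0) (s : RV v) :
    weight (Function.update f j (s * f j)) + {x : RV v | x = s ∧ s = 0}.ncard = weight f := by
  unfold weight
  by_cases hs : s = 0
  · have e : {i | f i ≠ rvInf v} =
        insert j {i | Function.update f j (s * f j) i ≠ rvInf v} := by
      ext i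
      by_cases h : i = j
      · subst h; simpa using hj
      · simp [h]
    have e' : {x : RV v | x = s ∧ s = 0} = {s} := by ext; simp [hs]
    rw [e, Set.ncard_insert_of_notMem (by simp [hs]), e', Set.ncard_singleton]
  · have e : {i | f i ≠ rvInf v} = {i | Function.update f j (s * f j) i ≠ rvInf v} := by
      ext i
      by_cases h : i = j
      · subst h; simp [hj, hs]
      · simp [h]
    rw [e]
    simp [hs]

/-- The cardinality in `weight_update_mul` is the indicator of `s = ∞`. It involves neither the
tuple nor the coordinate, so both weights drop by the same amount. -/
lemma weight_update_mul_le {m n : ℕ} {f : Fin n → RV v} {g : Fin m → RV v} {i : Fin n} {j : Fin m}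
    (hi : f i ≠ 0) (hj : g j ≠ 0) (h : weight f ≤ weight g) (s : RV v) :
    weight (Function.update f i (s * f i)) ≤ weight (Function.update g j (s * g j)) := by
  have h1 := weight_update_mul f i hi s
  have h2 := weight_update_mul g j hj s
  omega

/-- The map is `F × id`, and no relation between `i` and `j` is needed. For a value `t` of the blown
up map, both the image under `Z.map ∘ F` and the factor `s` are confined to finite sets. -/
lemma IsMorphism.elemBlowup {κ : Cardinal.{max u w}} (hκ : ℵ₀ ≤ κ)
    (hsat : IsSaturated LRV (Elem v) κ) (hS : #S < κ) {Y Z : RVObj S k} {i j : Fin k}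
    (hY : Y.CanBlowup i) (hZ : Z.CanBlowup j) {F : Y.carrier ≃ Z.carrier}
    (hF : IsMorphism Y Z F) :
    IsMorphism (Y.elemBlowup i) (Z.elemBlowup j) ((elemBlowupEquiv Y i).symm.trans
      ((Equiv.prodCongr F (Equiv.refl _)).trans (elemBlowupEquiv Z j))) where
  graph_def := by
    refine DefFam.equiv (S := S) (elemBlowupEquiv Y i) ?_
    simp only [Equiv.trans_apply, Equiv.symm_apply_apply, Equiv.prodCongr_apply, Prod.map,
      elemBlowupEquiv_val, Equiv.refl_apply]
    exact (DefFam.prod (S := S) (h := fun u : Y.carrier => Sum.elim u.1 (F u).1)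
      hF.graph_def DefFam.gt_one).comp
        (((DefTuple.coord fun i => Sum.inl (Sum.inl i)).append (DefTuple.coord Sum.inr)).sum
        ((DefTuple.coord fun i => Sum.inl (Sum.inr i)).append (DefTuple.coord Sum.inr)))
  volumetric u := by
    obtain ⟨p, rfl⟩ := (elemBlowupEquiv Y i).surjective u
    simpa using weight_update_mul_le (hY p.1).2 (hZ (F p.1)).2 (hF.volumetric p.1) p.2.1
  finite t ht := by
    -- Off `i` the tuple `t` agrees with `f(u)`, which leaves finitely many `f(u)`; over each of
    -- them `F` gives finitely many values.
    have h1 : ((fun u => Z.map (F u)) '' {u | ∀ a, a ≠ i → Y.map u a = t a}).Finite := by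
      refine ((hY.finite_fiber hκ hsat hS t).biUnion (t := fun f =>
        (fun u => Z.map (F u)) '' (Y.map ⁻¹' {f})) fun f hf => hF.finite f hf.1).subset ?_
      rintro _ ⟨u, hu, rfl⟩
      exact Set.mem_biUnion (x := Y.map u) ⟨⟨u, rfl⟩, hu⟩ ⟨u, rfl, rfl⟩
    -- From `t i = s * f i` with `f i ≠ ∞` the factor is recovered as `s = t i / f i`, also for `s =
    -- ∞`, which is the zero of `RV`.
    have h2 : ((fun f : Fin k → RV v => t i / f i) ''
        {f | f ∈ Set.range Y.map ∧ ∀ a, a ≠ i → f a = t a}).Finite :=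
      (hY.finite_fiber hκ hsat hS t).image _
    refine (h1.image2 (fun g s => Function.update g j (s * g j)) h2).subset ?_
    rintro _ ⟨u, hu, rfl⟩
    obtain ⟨p, rfl⟩ := (elemBlowupEquiv Y i).surjective u
    simp only [Set.mem_preimage, map_elemBlowupEquiv, Set.mem_singleton_iff] at hu
    subst hu
    refine ⟨_, ⟨p.1, fun a ha => ?_, rfl⟩, p.2.1, ⟨Y.map p.1, ⟨⟨_, rfl⟩, fun a ha => ?_⟩, ?_⟩, ?_⟩
    · simp [ha]
    · simp [ha]
    · simp [mul_div_cancel_right₀ _ (hY p.1).2]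
    · simp

/-- Elementary blowups of isomorphic objects are isomorphic. -/
lemma Isomorphic.elemBlowup {κ : Cardinal.{max u w}} (hκ : ℵ₀ ≤ κ)
    (hsat : IsSaturated LRV (Elem v) κ) (hS : #S < κ) {Y Z : RVObj S k} {i j : Fin k}
    (hY : Y.CanBlowup i) (hZ : Z.CanBlowup j) :
    Isomorphic Y Z → Isomorphic (Y.elemBlowup i) (Z.elemBlowup j) :=
  fun ⟨_, h1, h2⟩ => ⟨_, h1.elemBlowup hκ hsat hS hY hZ, h2.elemBlowup hκ hsat hS hZ hY⟩

lemma elemBlowup_prod_iso (Y : RVObj S k) (Z : RVObj S l) (j : Fin k) :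
    Isomorphic ((Y.prod Z).elemBlowup (Fin.castAdd l j)) ((Y.elemBlowup j).prod Z) := by
  refine Isomorphic.ofParam (T := (Y.carrier × Z.carrier) × {s : RV v // vrv v s < 1})
    ((Equiv.prodCongr (prodEquiv Y Z) (Equiv.refl _)).trans (elemBlowupEquiv _ _))
    (((Equiv.prodAssoc _ _ _).trans ((Equiv.prodCongr (Equiv.refl _) (Equiv.prodComm _ _)).trans
      (Equiv.prodAssoc _ _ _).symm)).trans
      ((Equiv.prodCongr (elemBlowupEquiv Y j) (Equiv.refl _)).trans (prodEquiv _ _)))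
    (Equiv.refl _) ?_ ?_
  · exact ((Y.fam'.prod Z.fam').prod DefFam.gt_one).comp
      ((((DefTuple.coord fun i => Sum.inl (Sum.inl i)).append
        (DefTuple.coord fun i => Sum.inl (Sum.inr i))).append (DefTuple.coord Sum.inr)).sum
      (((DefTuple.coord fun i => Sum.inl (Sum.inl i)).append (DefTuple.coord Sum.inr)).append
        (DefTuple.coord fun i => Sum.inl (Sum.inr i))))
  · rintro ⟨⟨y, z⟩, s⟩ a
    refine Fin.addCases (fun a => ?_) (fun a => ?_) a
    · by_cases h : a = j
      · subst h; simp
      · have : Fin.castAdd l a ≠ Fin.castAdd l j := fun h' => h (Fin.castAdd_injective _ _ h')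
        simp [h, this]
    · have : Fin.natAdd k a ≠ Fin.castAdd l j := by
        intro h
        have := congrArg Fin.val h
        simp at this
        omega
      simp [this]

lemma InAcl.mono {A B : Set (RV v)} (h : A ⊆ B) {b : RV v} : InAcl S A b → InAcl S B b :=
  fun ⟨D, h1, h2⟩ =>
    ⟨D, h1.mono (Set.union_subset_union_right S (Set.image_mono h)), h2⟩

lemma RVObj.CanBlowup.prod {Y : RVObj S k} {j : Fin k} (hY : Y.CanBlowup j) (Z : RVObj S l) :
    (Y.prod Z).CanBlowup (Fin.castAdd l j) := by
  intro t
  obtain ⟨⟨y, z⟩, rfl⟩ := (prodEquiv Y Z).surjective t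
  simp only [map_prodEquiv, Fin.append_left]
  refine ⟨(hY y).1.mono ?_, (hY y).2⟩
  rintro _ ⟨i, hi, rfl⟩
  exact ⟨Fin.castAdd l i, fun h => hi (Fin.castAdd_injective _ _ h), by simp⟩

lemma RVObj.CanBlowup.restrict {Y : RVObj S k} {j : Fin k} (hY : Y.CanBlowup j)
    {C : Set (Fin Y.dim → RV v)} (hC : RVDef S C) : (Y.restrict C hC).CanBlowup j :=
  fun t => hY ⟨t.1, t.2.1⟩

end Blowup

/-! ### Definable decompositions and the refinement property. -/

section Refinement

variable {K : Type u} [Field K] {Γ₀ : Type w} [LinearOrderedCommGroupWithZero Γ₀]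
  {v : Valuation K Γ₀} {S : Set (Elem v)} {k l : ℕ}

lemma RVObj.cls_eq {X Y : RVObj S k} : X.cls = Y.cls ↔ Isomorphic X Y := Quotient.eq

lemma RVObj.cls_sum (X Y : RVObj S k) : (X.sum Y).cls = X.cls + Y.cls := rfl

/-- The inclusion of a subobject. -/
def RVObj.incl (X : RVObj S k) {C : Set (Fin X.dim → RV v)} (hC : RVDef S C) :
    (X.restrict C hC).carrier → X.carrier := fun u => ⟨u.1, u.2.1⟩

lemma RVObj.restrict_cls_eq (X : RVObj S k) {C D : Set (Fin X.dim → RV v)} (hC : RVDef S C)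
    (hD : RVDef S D) (h : X.carrier ∩ C = X.carrier ∩ D) :
    (X.restrict C hC).cls = (X.restrict D hD).cls := by
  refine RVObj.cls_eq.2 (Isomorphic.ofParam (T := (X.restrict C hC).carrier) (Equiv.refl _)
    (Equiv.setCongr h) (Equiv.refl _) ?_ fun _ _ => rfl)
  exact (X.restrict C hC).fam'.comp ((DefTuple.coord id).sum (DefTuple.coord id))

lemma RVObj.restrict_comm (X : RVObj S k) {C D : Set (Fin X.dim → RV v)} (hC : RVDef S C)
    (hD : RVDef S D) :
    ((X.restrict C hC).restrict D hD).cls = ((X.restrict D hD).restrict C hC).cls := by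
  refine RVObj.cls_eq.2 (Isomorphic.ofParam (T := ((X.restrict C hC).restrict D hD).carrier)
    (Equiv.refl _) (Equiv.setCongr (Set.inter_right_comm _ _ _)) (Equiv.refl _) ?_ fun _ _ => rfl)
  exact ((X.restrict C hC).restrict D hD).fam'.comp ((DefTuple.coord id).sum (DefTuple.coord id))

open Classical in
/-- An object is the disjoint union of a definable subset and its complement. -/
noncomputable def restrictEquiv (X : RVObj S k) {C : Set (Fin X.dim → RV v)} (hC : RVDef S C) :
    (X.restrict C hC).carrier ⊕ (X.restrict Cᶜ hC.compl).carrier ≃ X.carrier where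
  toFun := Sum.elim (X.incl hC) (X.incl hC.compl)
  invFun u := if h : u.1 ∈ C then Sum.inl ⟨u.1, u.2, h⟩ else Sum.inr ⟨u.1, u.2, h⟩
  left_inv := by
    rintro (⟨u, hu, hc⟩ | ⟨u, hu, hc⟩)
    · exact dif_pos hc
    · exact dif_neg hc
  right_inv u := by
    by_cases h : u.1 ∈ C <;> simp [h, RVObj.incl]

lemma RVObj.restrict_sum_iso (X : RVObj S k) {C : Set (Fin X.dim → RV v)} (hC : RVDef S C) :
    Isomorphic X ((X.restrict C hC).sum (X.restrict Cᶜ hC.compl)) := by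
  refine Isomorphic.ofParam (restrictEquiv X hC) (sumEquiv _ _) (Equiv.refl _)
    (DefFam.sum ?_ ?_) ?_
  · exact (X.restrict C hC).fam'.comp ((DefTuple.coord id).sum (DefTuple.coord id).inlCode)
  · exact (X.restrict Cᶜ hC.compl).fam'.comp ((DefTuple.coord id).sum (DefTuple.coord id).inrCode)
  · rintro (t | t) i <;> rw [map_sumEquiv] <;> rfl

lemma RVObj.cls_restrict_add (X : RVObj S k) {C : Set (Fin X.dim → RV v)} (hC : RVDef S C) :
    X.cls = (X.restrict C hC).cls + (X.restrict Cᶜ hC.compl).cls :=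
  RVObj.cls_eq.2 (X.restrict_sum_iso hC)

/-- Product with `RV^{>1}` distributes over the decomposition along `C`. This makes elementary
blowups additive on classes. -/
lemma elemBlowup_restrict_iso (X : RVObj S k) (j : Fin k) {C : Set (Fin X.dim → RV v)}
    (hC : RVDef S C) : Isomorphic (X.elemBlowup j)
      (((X.restrict C hC).elemBlowup j).sum ((X.restrict Cᶜ hC.compl).elemBlowup j)) := by
  refine Isomorphic.ofParam
    ((Equiv.sumProdDistrib _ _ _).symm.trans
      ((Equiv.prodCongr (restrictEquiv X hC) (Equiv.refl _)).trans (elemBlowupEquiv X j)))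
    ((Equiv.sumCongr (elemBlowupEquiv _ j) (elemBlowupEquiv _ j)).trans (sumEquiv _ _))
    (Equiv.refl _) (DefFam.sum ?_ ?_) ?_
  · exact ((X.restrict C hC).fam'.prod DefFam.gt_one).comp
      (((DefTuple.coord Sum.inl).append (DefTuple.coord Sum.inr)).sum
        ((DefTuple.coord Sum.inl).append (DefTuple.coord Sum.inr)).inlCode)
  · exact ((X.restrict Cᶜ hC.compl).fam'.prod DefFam.gt_one).comp
      (((DefTuple.coord Sum.inl).append (DefTuple.coord Sum.inr)).sum
        ((DefTuple.coord Sum.inl).append (DefTuple.coord Sum.inr)).inrCode)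
  · rintro (t | t) i
    · simp [restrictEquiv]; rfl
    · simp [restrictEquiv]; rfl

/-- A restriction of a morphism to subobjects is a morphism. -/
lemma IsMorphism.of_comm {X Y X' Y' : RVObj S k} {F : X.carrier → Y.carrier}
    (hF : IsMorphism X Y F) {a : X'.carrier → X.carrier} {b : Y'.carrier → Y.carrier}
    (hb : Function.Injective b) (ha' : DefFam S fun u => Sum.elim u.1 (a u).1)
    (hb' : DefFam S fun u => Sum.elim u.1 (b u).1) (hma : ∀ u, X'.map u = X.map (a u))
    (hmb : ∀ u, Y'.map u = Y.map (b u)) {F' : X'.carrier → Y'.carrier}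
    (h : ∀ u, F (a u) = b (F' u)) : IsMorphism X' Y' F' where
  graph_def := by
    -- As `b` is injective, `(x, y)` lies on the graph of `F'` exactly if `(a x, b y)` lies on the
    -- graph of `F`. The graph is thus obtained by an existential quantifier over `(a x, b y)`.
    have h1 := ha'.preimage (β := (Fin X'.dim ⊕ Fin Y'.dim) ⊕ (Fin X.dim ⊕ Fin Y.dim))
      (Sum.elim (fun i => Sum.inl (Sum.inl i)) (fun i => Sum.inr (Sum.inl i)))
    have h2 := hb'.preimage (β := (Fin X'.dim ⊕ Fin Y'.dim) ⊕ (Fin X.dim ⊕ Fin Y.dim))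
      (Sum.elim (fun i => Sum.inl (Sum.inr i)) (fun i => Sum.inr (Sum.inr i)))
    have h3 := hF.graph_def.preimage (β := (Fin X'.dim ⊕ Fin Y'.dim) ⊕ (Fin X.dim ⊕ Fin Y.dim))
      Sum.inr
    convert ((h1.inter h2).inter h3).exists using 1
    ext z
    simp only [Set.mem_range, Set.mem_inter_iff, Set.mem_ofPred_eq]
    constructor
    · rintro ⟨u, rfl⟩
      refine ⟨Sum.elim (a u).1 (F (a u)).1, ⟨⟨u, ?_⟩, ⟨F' u, ?_⟩⟩, ⟨a u, ?_⟩⟩ <;>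
        · funext i; rcases i with i | i <;> simp [h]
    · rintro ⟨s, ⟨⟨x, hx⟩, ⟨y, hy⟩⟩, ⟨x', hx'⟩⟩
      have e1 : a x = x' := Subtype.ext (funext fun i => by
        have e1 := congrFun hx (Sum.inr i)
        have e2 := congrFun hx' (Sum.inl i)
        simp at e1 e2
        rw [e1, e2])
      have e2 : b y = F x' := Subtype.ext (funext fun i => by
        have e1 := congrFun hy (Sum.inr i)
        have e2 := congrFun hx' (Sum.inr i)
        simp at e1 e2
        rw [e1, e2])
      rw [← e1, h] at e2
      obtain rfl := hb e2
      refine ⟨x, ?_⟩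
      funext i
      rcases i with i | i
      · simpa using congrFun hx (Sum.inl i)
      · simpa using congrFun hy (Sum.inl i)
  volumetric u := by rw [hma, hmb, ← h]; exact hF.volumetric _
  finite t ht := by
    obtain ⟨u, rfl⟩ := ht
    refine (hF.finite (X'.map u) ⟨a u, (hma u).symm⟩).subset ?_
    rintro _ ⟨x, hx, rfl⟩
    exact ⟨a x, (hma x).symm.trans hx, by simp only [hmb, h]⟩

/-- An isomorphism restricts to subobjects that it matches. Subobjects enter as embeddings, so that
a subset of `X` can be compared with a summand of a disjoint union, whose points are recoded. -/
lemma Isomorphic.of_comm {X Y X' Y' : RVObj S k} {F : X.carrier ≃ Y.carrier}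
    (hF : IsMorphism X Y F) (hF' : IsMorphism Y X F.symm)
    {a : X'.carrier → X.carrier} {b : Y'.carrier → Y.carrier}
    (ha : Function.Injective a) (hb : Function.Injective b)
    (ha' : DefFam S fun u => Sum.elim u.1 (a u).1)
    (hb' : DefFam S fun u => Sum.elim u.1 (b u).1) (hma : ∀ u, X'.map u = X.map (a u))
    (hmb : ∀ u, Y'.map u = Y.map (b u)) (h : F '' Set.range a = Set.range b) :
    Isomorphic X' Y' := by
  let F' : X'.carrier ≃ Y'.carrier := (Equiv.ofInjective a ha).trans
    ((F.image _).trans ((Equiv.setCongr h).trans (Equiv.ofInjective b hb).symm))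
  have hF'eq : ∀ u, F (a u) = b (F' u) := by
    intro u
    simp [F', Equiv.apply_ofInjective_symm]
  refine ⟨F', hF.of_comm hb ha' hb' hma hmb hF'eq, hF'.of_comm ha hb' ha' hmb hma fun u => ?_⟩
  rw [Equiv.symm_apply_eq, hF'eq, Equiv.apply_symm_apply]

/-- A decomposition of the class of an object comes from a decomposition of the object. -/
lemma RVObj.exists_restrict (X : RVObj S k) {c d : Gsk S k} (h : X.cls = c + d) :
    ∃ (C : Set (Fin X.dim → RV v)) (hC : RVDef S C),
      (X.restrict C hC).cls = c ∧ (X.restrict Cᶜ hC.compl).cls = d := by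
  obtain ⟨Y, rfl⟩ := Quotient.exists_rep c
  obtain ⟨Z, rfl⟩ := Quotient.exists_rep d
  obtain ⟨F, hF, hF'⟩ : Isomorphic X (Y.sum Z) := RVObj.cls_eq.1 h
  -- `C` is the part of `X` that the isomorphism sends to the first summand.
  let C : Set (Fin X.dim → RV v) := Set.range fun y => (F.symm (sumEquiv Y Z (Sum.inl y))).1
  have hinv : ∀ {t : X.carrier} {y}, t.1 = (F.symm (sumEquiv Y Z y)).1 ↔ F t = sumEquiv Y Z y := by
    intro t y
    rw [← Subtype.ext_iff, Equiv.eq_symm_apply]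
  have hC : RVDef S C := by
    have h1 := hF'.graph_def.preimage (β := Fin X.dim ⊕ Fin (Y.sum Z).dim) Sum.swap
    have h2 : RVDef S (Set.range fun y : Y.carrier => (sumEquiv Y Z (Sum.inl y)).1) :=
      Y.fam'.comp (DefTuple.coord id).inlCode
    convert (h1.inter (h2.preimage Sum.inr)).exists using 1
    ext z
    simp only [Set.mem_range, Set.mem_inter_iff, Set.mem_ofPred_eq, C]
    constructor
    · rintro ⟨y, rfl⟩
      refine ⟨(sumEquiv Y Z (Sum.inl y)).1, ⟨sumEquiv Y Z (Sum.inl y), ?_⟩, y, rfl⟩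
      funext i; rcases i with i | i <;> rfl
    · rintro ⟨s, ⟨y', hy'⟩, y, hy⟩
      have e : y' = sumEquiv Y Z (Sum.inl y) := Subtype.ext (funext fun i => by
        rw [hy]; exact congrFun hy' (Sum.inl i))
      subst e
      exact ⟨y, funext fun i => congrFun hy' (Sum.inr i)⟩
  have hmem : ∀ t : X.carrier, t.1 ∈ C ↔ ∃ y, F t = sumEquiv Y Z (Sum.inl y) := by
    intro t
    simp only [C, Set.mem_range, eq_comm (b := t.1), hinv]
  have hmem' : ∀ t : X.carrier, t.1 ∈ Cᶜ ↔ ∃ z, F t = sumEquiv Y Z (Sum.inr z) := by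
    intro t
    rw [Set.mem_compl_iff, hmem]
    obtain ⟨p, hp⟩ := (sumEquiv Y Z).surjective (F t)
    rw [← hp]
    rcases p with p | p <;> simp
  refine ⟨C, hC, RVObj.cls_eq.2 ?_, RVObj.cls_eq.2 ?_⟩
  · refine Isomorphic.of_comm hF hF' (a := X.incl hC) (b := fun y => sumEquiv Y Z (Sum.inl y))
      (fun x y h => Subtype.ext (congrArg (fun t => t.1) h))
      (fun x y h => Sum.inl_injective ((sumEquiv Y Z).injective h))
      ((X.restrict C hC).fam'.comp ((DefTuple.coord id).sum (DefTuple.coord id)))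
      (Y.fam'.comp ((DefTuple.coord id).sum (DefTuple.coord id).inlCode))
      (fun _ => rfl) (fun u => by simp) ?_
    ext y
    constructor
    · rintro ⟨_, ⟨u, rfl⟩, rfl⟩
      obtain ⟨y, hy⟩ := (hmem (X.incl hC u)).1 u.2.2
      exact ⟨y, hy.symm⟩
    · rintro ⟨y, rfl⟩
      exact ⟨_, ⟨⟨(F.symm (sumEquiv Y Z (Sum.inl y))).1, Subtype.coe_prop _,
        (hmem _).2 ⟨y, by simp⟩⟩, rfl⟩, F.apply_symm_apply _⟩
  · refine Isomorphic.of_comm hF hF' (a := X.incl hC.compl)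
      (b := fun y => sumEquiv Y Z (Sum.inr y))
      (fun x y h => Subtype.ext (congrArg (fun t => t.1) h))
      (fun x y h => Sum.inr_injective ((sumEquiv Y Z).injective h))
      ((X.restrict Cᶜ hC.compl).fam'.comp ((DefTuple.coord id).sum (DefTuple.coord id)))
      (Z.fam'.comp ((DefTuple.coord id).sum (DefTuple.coord id).inrCode))
      (fun _ => rfl) (fun u => by simp) ?_
    ext y
    constructor
    · rintro ⟨_, ⟨u, rfl⟩, rfl⟩
      obtain ⟨y, hy⟩ := (hmem' (X.incl hC.compl u)).1 u.2.2
      exact ⟨y, hy.symm⟩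
    · rintro ⟨y, rfl⟩
      exact ⟨_, ⟨⟨(F.symm (sumEquiv Y Z (Sum.inr y))).1, Subtype.coe_prop _,
        (hmem' _).2 ⟨y, by simp⟩⟩, rfl⟩, F.apply_symm_apply _⟩

/-- `K₊RV[k, ·]` is a refinement monoid. -/
lemma Gsk.refinement {a b c d : Gsk S k} (h : a + b = c + d) :
    ∃ p q r s : Gsk S k, a = p + q ∧ b = r + s ∧ c = p + r ∧ d = q + s := by
  obtain ⟨X, hX⟩ := Quotient.exists_rep (a + b)
  obtain ⟨C, hC, rfl, rfl⟩ := X.exists_restrict hX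
  obtain ⟨D, hD, rfl, rfl⟩ := X.exists_restrict (hX.trans h)
  -- Both decompositions live on one object `X`, cut along `C` and along `D`; the four classes are
  -- those of `C ∩ D`, `C \ D`, `D \ C` and the remainder.
  refine ⟨_, _, _, _, (X.restrict C hC).cls_restrict_add (C := D) hD,
    (X.restrict Cᶜ hC.compl).cls_restrict_add (C := D) hD, ?_, ?_⟩
  · exact ((X.restrict D hD).cls_restrict_add (C := C) hC).trans
      (congrArg₂ (· + ·) (X.restrict_comm hD hC) (X.restrict_comm hD hC.compl))
  · exact ((X.restrict Dᶜ hD.compl).cls_restrict_add (C := C) hC).trans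
      (congrArg₂ (· + ·) (X.restrict_comm hD.compl hC) (X.restrict_comm hD.compl hC.compl))

end Refinement

/-! ### Blowups as a confluent rewriting relation on classes, and the congruences. -/

section Congruence

open Relation

variable {K : Type u} [Field K] {Γ₀ : Type w} [LinearOrderedCommGroupWithZero Γ₀]
  {v : Valuation K Γ₀} {S : Set (Elem v)} {k l : ℕ}

/-- Elementary blowups on isomorphism classes. -/
def ElemBlowupCls (a b : Gsk S k) : Prop :=
  ∃ (Y : RVObj S k) (j : Fin k), Y.CanBlowup j ∧ Y.cls = a ∧ (Y.elemBlowup j).cls = b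

/-- Neither the representative nor the coordinate matters, by `Isomorphic.elemBlowup`: the
elementary blowup is a partial function on classes. -/
lemma ElemBlowupCls.unique {κ : Cardinal.{max u w}} (hκ : ℵ₀ ≤ κ)
    (hsat : IsSaturated LRV (Elem v) κ) (hS : #S < κ) {a b c : Gsk S k}
    (hb : ElemBlowupCls a b) (hc : ElemBlowupCls a c) : b = c := by
  obtain ⟨Y, i, hY, rfl, rfl⟩ := hb
  obtain ⟨Z, j, hZ, h, rfl⟩ := hc
  exact RVObj.cls_eq.2 (Isomorphic.elemBlowup hκ hsat hS hY hZ (RVObj.cls_eq.1 h.symm))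

/-- The condition for blowing up is imposed point by point, so both pieces inherit it. -/
lemma ElemBlowupCls.split {a b c d : Gsk S k} (h : ElemBlowupCls a b) (ha : a = c + d) :
    ∃ c' d', ElemBlowupCls c c' ∧ ElemBlowupCls d d' ∧ b = c' + d' := by
  obtain ⟨Y, j, hY, rfl, rfl⟩ := h
  obtain ⟨C, hC, rfl, rfl⟩ := Y.exists_restrict ha
  exact ⟨_, _, ⟨_, j, hY.restrict hC, rfl, rfl⟩, ⟨_, j, hY.restrict hC.compl, rfl, rfl⟩,
    RVObj.cls_eq.2 (elemBlowup_restrict_iso Y j hC)⟩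

lemma ElemBlowupCls.mul {a b : Gsk S k} (h : ElemBlowupCls a b) (c : Gsk S l) :
    ElemBlowupCls (GradedMonoid.GMul.mul a c) (GradedMonoid.GMul.mul b c) := by
  obtain ⟨Y, j, hY, rfl, rfl⟩ := h
  obtain ⟨Z, rfl⟩ := Quotient.exists_rep c
  exact ⟨_, _, hY.prod Z, rfl, RVObj.cls_eq.2 (elemBlowup_prod_iso Y Z j)⟩

/-- Blowups on isomorphism classes. -/
def BlowupCls (a b : Gsk S k) : Prop :=
  ∃ c c' r, ElemBlowupCls c c' ∧ a = c + r ∧ b = c' + r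

lemma BlowupCls.add {a b : Gsk S k} (h : BlowupCls a b) (c : Gsk S k) :
    BlowupCls (a + c) (b + c) := by
  obtain ⟨p, p', r, h, rfl, rfl⟩ := h
  exact ⟨p, p', r + c, h, add_assoc _ _ _, add_assoc _ _ _⟩

lemma BlowupCls.mul {a b : Gsk S k} (h : BlowupCls a b) (c : Gsk S l) :
    BlowupCls (GradedMonoid.GMul.mul a c) (GradedMonoid.GMul.mul b c) := by
  obtain ⟨p, p', r, h, rfl, rfl⟩ := h
  exact ⟨_, _, _, h.mul c, DirectSum.GNonUnitalNonAssocSemiring.add_mul _ _ _,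
    DirectSum.GNonUnitalNonAssocSemiring.add_mul _ _ _⟩

/-- Refine to `x = p + q`, `r = m + n`, `y = p + m`, `t = q + n`, where `x` and `y` are the two
loci. Both sides blow up `p`, with the same result by uniqueness. Blowing up `m` on one side and `q`
on the other makes them equal. -/
lemma BlowupCls.diamond {κ : Cardinal.{max u w}} (hκ : ℵ₀ ≤ κ)
    (hsat : IsSaturated LRV (Elem v) κ) (hS : #S < κ) {a b c : Gsk S k}
    (hb : BlowupCls a b) (hc : BlowupCls a c) : ∃ d, BlowupCls b d ∧ BlowupCls c d := by
  obtain ⟨x, x', r, hx, rfl, rfl⟩ := hb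
  obtain ⟨y, y', t, hy, h, rfl⟩ := hc
  obtain ⟨p, q, m, n, hxpq, rfl, hypm, rfl⟩ := Gsk.refinement h
  obtain ⟨p₁, q', hp₁, hq', rfl⟩ := hx.split hxpq
  obtain ⟨p₂, m', hp₂, hm', rfl⟩ := hy.split hypm
  obtain rfl := hp₁.unique hκ hsat hS hp₂
  exact ⟨p₁ + q' + (m' + n), ⟨m, m', p₁ + q' + n, hm', by abel, by abel⟩,
    ⟨q, q', p₁ + m' + n, hq', by abel, by abel⟩⟩

lemma IsBlowup.cls {X X' : RVObj S k} : IsBlowup X X' → BlowupCls X.cls X'.cls := by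
  rintro ⟨C, hC, Y, j, -, hY, hj, rfl⟩
  refine ⟨_, _, _, ⟨Y, j, hj, rfl, rfl⟩, ?_, RVObj.cls_sum _ _⟩
  rw [RVObj.cls_eq.2 hY]
  exact X.cls_restrict_add hC

/-- Blowups of classes lift to any given representative, since a decomposition of the class is
realised inside the object. -/
lemma BlowupCls.exists_isBlowup {X : RVObj S k} {b : Gsk S k} (h : BlowupCls X.cls b) :
    ∃ X', IsBlowup X X' ∧ X'.cls = b := by
  obtain ⟨_, _, r, ⟨Y, j, hj, rfl, rfl⟩, hX, rfl⟩ := h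
  obtain ⟨C, hC, hY, rfl⟩ := X.exists_restrict hX
  -- The locus of a blowup must be contained in `X`; intersecting with `X` changes neither piece up
  -- to isomorphism.
  have hC' := X.carrier_def.inter hC
  refine ⟨_, ⟨_, hC', Y, j, Set.inter_subset_left, ?_, hj, rfl⟩, ?_⟩
  · rw [← RVObj.cls_eq, ← hY]
    exact X.restrict_cls_eq hC hC' (by ext; simp)
  · rw [RVObj.cls_sum]
    congr 1
    exact X.restrict_cls_eq hC'.compl hC.compl (by ext; simp +contextual)

lemma IsIteratedBlowup.cls {X X' : RVObj S k} (h : IsIteratedBlowup X X') :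
    ReflTransGen BlowupCls X.cls X'.cls :=
  ReflTransGen.lift RVObj.cls (fun _ _ => IsBlowup.cls) _ _ h

lemma exists_isIteratedBlowup {X : RVObj S k} {b : Gsk S k}
    (h : ReflTransGen BlowupCls X.cls b) : ∃ X', IsIteratedBlowup X X' ∧ X'.cls = b := by
  induction h with
  | refl => exact ⟨X, ReflTransGen.refl, rfl⟩
  | tail _ h ih =>
    obtain ⟨Y, hY, rfl⟩ := ih
    obtain ⟨Z, hZ, rfl⟩ := h.exists_isBlowup
    exact ⟨Z, hY.tail hZ, rfl⟩

/-- The right-hand side sees only classes, so the relation on objects is invariant under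
isomorphism, and abstract rewriting applies. -/
lemma isp_iff {X Y : RVObj S k} :
    Isp X Y ↔ Join (ReflTransGen BlowupCls) X.cls Y.cls := by
  constructor
  · rintro ⟨X', Y', hX, hY, h⟩
    exact ⟨X'.cls, hX.cls, by rw [RVObj.cls_eq.2 h]; exact hY.cls⟩
  · rintro ⟨c, hX, hY⟩
    obtain ⟨X', hX', rfl⟩ := exists_isIteratedBlowup hX
    obtain ⟨Y', hY', h⟩ := exists_isIteratedBlowup hY
    exact ⟨X', Y', hX', hY', RVObj.cls_eq.1 h.symm⟩

lemma ispCls_iff {a b : Gsk S k} : IspCls a b ↔ Join (ReflTransGen BlowupCls) a b := by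
  constructor
  · rintro ⟨X, Y, rfl, rfl, h⟩
    exact isp_iff.1 h
  · intro h
    obtain ⟨X, rfl⟩ := Quotient.exists_rep a
    obtain ⟨Y, rfl⟩ := Quotient.exists_rep b
    exact ⟨X, Y, rfl, rfl, isp_iff.2 h⟩

lemma IspCls.equivalence {κ : Cardinal.{max u w}} (hκ : ℵ₀ ≤ κ)
    (hsat : IsSaturated LRV (Elem v) κ) (hS : #S < κ) :
    Equivalence (IspCls : Gsk S k → Gsk S k → Prop) := by
  -- Only transitivity of joinability is in question, and it follows from confluence, which the
  -- diamond property yields.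
  have h := equivalence_join_reflTransGen (r := (BlowupCls : Gsk S k → Gsk S k → Prop))
    fun a b c hb hc => by
      obtain ⟨d, h1, h2⟩ := BlowupCls.diamond hκ hsat hS hb hc
      exact ⟨d, ReflGen.single h1, ReflTransGen.single h2⟩
  exact ⟨fun a => ispCls_iff.2 (h.refl a), fun h' => ispCls_iff.2 (h.symm (ispCls_iff.1 h')),
    fun h1 h2 => ispCls_iff.2 (h.trans (ispCls_iff.1 h1) (ispCls_iff.1 h2))⟩

/-- A map that preserves single blowups carries a common iterated blowup to a common iterated
blowup. It serves for adding a class and for multiplying by one. -/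
lemma IspCls.map {a b : Gsk S k} (f : Gsk S k → Gsk S l)
    (hf : ∀ a b, BlowupCls a b → BlowupCls (f a) (f b)) (h : IspCls a b) :
    IspCls (f a) (f b) := by
  obtain ⟨c, h1, h2⟩ := ispCls_iff.1 h
  exact ispCls_iff.2 ⟨f c, h1.lift f hf, h2.lift f hf⟩

lemma IspCls.add_right {a b : Gsk S k} (h : IspCls a b) (c : Gsk S k) : IspCls (a + c) (b + c) :=
  h.map (· + c) fun _ _ h => h.add c

lemma IspCls.mul_right {a b : Gsk S k} (h : IspCls a b) (c : Gsk S l) :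
    IspCls (GradedMonoid.GMul.mul a c) (GradedMonoid.GMul.mul b c) :=
  h.map (GradedMonoid.GMul.mul · c) fun _ _ h => h.mul c

/-- `I_sp[k, ·]` as a congruence relation on `K₊RV[k, ·]`. -/
def ispAddCon {κ : Cardinal.{max u w}} (hκ : ℵ₀ ≤ κ)
    (hsat : IsSaturated LRV (Elem v) κ) (hS : #S < κ) (k : ℕ) : AddCon (Gsk S k) where
  r := IspCls
  iseqv := IspCls.equivalence hκ hsat hS
  add' {a b c d} hab hcd := by
    refine (IspCls.equivalence hκ hsat hS).trans (hab.add_right c) ?_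
    rw [add_comm b c, add_comm b d]
    exact hcd.add_right b

/-- `I_sp[*, ·]` as a congruence relation of the additive monoid `K₊RV[*, ·]`. -/
def ispStarAddCon {κ : Cardinal.{max u w}} (hκ : ℵ₀ ≤ κ)
    (hsat : IsSaturated LRV (Elem v) κ) (hS : #S < κ) : AddCon (GskStar S) where
  r := IspStar
  iseqv := ⟨fun x k => (ispAddCon hκ hsat hS k).refl (x k),
    fun h k => (ispAddCon hκ hsat hS k).symm (h k),
    fun h h' k => (ispAddCon hκ hsat hS k).trans (h k) (h' k)⟩
  add' {a b c d} hab hcd k := by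
    rw [DirectSum.add_apply, DirectSum.add_apply]
    exact (ispAddCon hκ hsat hS k).add (hab k) (hcd k)

lemma IspStar.of {κ : Cardinal.{max u w}} (hκ : ℵ₀ ≤ κ)
    (hsat : IsSaturated LRV (Elem v) κ) (hS : #S < κ) {a b : Gsk S k} (h : IspCls a b) :
    IspStar (DirectSum.of (Gsk S) k a) (DirectSum.of (Gsk S) k b) := by
  intro i
  by_cases hi : k = i
  · subst hi
    simpa only [DirectSum.of_eq_same] using h
  · simp only [DirectSum.of_eq_of_ne _ _ _ (Ne.symm hi)]
    exact (ispAddCon hκ hsat hS i).refl 0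

lemma IspStar.mul_right {κ : Cardinal.{max u w}} (hκ : ℵ₀ ≤ κ)
    (hsat : IsSaturated LRV (Elem v) κ) (hS : #S < κ) {x y : GskStar S} (h : IspStar x y)
    (z : GskStar S) : IspStar (x * z) (y * z) := by
  classical
  let con := ispStarAddCon hκ hsat hS
  have key : ∀ i (c : Gsk S i), IspStar (x * DirectSum.of (Gsk S) i c)
      (y * DirectSum.of (Gsk S) i c) := by
    intro i c
    -- Expanding `x` and `y` over the union of their supports gives sums with the same index set,
    -- which can be compared term by term.
    have hsum : ∀ t : GskStar S, DFinsupp.support t ⊆ DFinsupp.support x ∪ DFinsupp.support y →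
        t * DirectSum.of (Gsk S) i c = ∑ j ∈ DFinsupp.support x ∪ DFinsupp.support y,
          DirectSum.of (Gsk S) (j + i) (GradedMonoid.GMul.mul (t j) c) := by
      intro t ht
      have : t = ∑ j ∈ DFinsupp.support x ∪ DFinsupp.support y, DirectSum.of (Gsk S) j (t j) := by
        conv_lhs => rw [← DirectSum.sum_support_of t]
        refine Finset.sum_subset ht fun j _ hj => ?_
        rw [DFinsupp.notMem_support_iff.1 hj, map_zero]
      conv_lhs => rw [this, Finset.sum_mul]
      exact Finset.sum_congr rfl fun j _ => DirectSum.of_mul_of _ _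
    rw [hsum x Finset.subset_union_left, hsum y Finset.subset_union_right]
    exact con.finsetSum _ fun j _ => IspStar.of hκ hsat hS ((h j).mul_right c)
  induction z using DirectSum.induction_on with
  | zero => rw [mul_zero, mul_zero]; exact con.refl 0
  | of i c => exact key i c
  | add z z' h1 h2 => rw [mul_add, mul_add]; exact con.add h1 h2

/-- `I_sp[*, ·]` as a congruence relation of the semiring `K₊RV[*, ·]`. -/
def ispStarRingCon {κ : Cardinal.{max u w}} (hκ : ℵ₀ ≤ κ)
    (hsat : IsSaturated LRV (Elem v) κ) (hS : #S < κ) : RingCon (GskStar S) where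
  __ := ispStarAddCon hκ hsat hS
  mul' {a b c d} hab hcd := by
    refine (ispStarAddCon hκ hsat hS).trans (IspStar.mul_right hκ hsat hS hab c) ?_
    rw [mul_comm b c, mul_comm b d]
    exact IspStar.mul_right hκ hsat hS hcd b

end Congruence

end ACVF

theorem mainTheorem11 {K : Type*} [Field K] [IsAlgClosed K] {Γ₀ : Type*}
    [LinearOrderedCommGroupWithZero Γ₀] (v : Valuation K Γ₀) (hv : Function.Surjective v)
    [CharZero (IsLocalRing.ResidueField v.valuationSubring)]
    (κ : Cardinal) (hκ : ℵ₀ ≤ κ) (hsat : ACVF.IsSaturated ACVF.LRV (ACVF.Elem v) κ)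
    (S : Set (ACVF.Elem v)) (hS : #S < κ) :
    (∀ k : ℕ, ∃ c : AddCon (ACVF.Gsk S k),
      ∀ X Y : ACVF.RVObj S k, c X.cls Y.cls ↔ ACVF.Isp X Y) ∧
    (∃ c : RingCon (ACVF.GskStar S),
      ∀ x y : ACVF.GskStar S, c x y ↔ ACVF.IspStar x y) :=
  -- `IspCls` asks only for some representatives that are related. Any others are then related too,
  -- as both relations amount to joinability of the classes.
  ⟨fun k => ⟨ACVF.ispAddCon hκ hsat hS k, fun _ _ => ACVF.ispCls_iff.trans ACVF.isp_iff.symm⟩,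
    ACVF.ispStarRingCon hκ hsat hS, fun _ _ => Iff.rfl⟩
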